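/- Let $\gamma>0$, $\rho^*>0$, $p(\rho)=\left(\frac1\rho-\frac1{\rho^*}\right)^{-\gamma}$ for $0<\rho<\rho^*$ and $p(0)=0$. For $\varepsilon>0$ consider the one-dimensional Euler system $$\partial_t\rho+\partial_x q=0,\qquad \partial_t q+\partial_x\Big(\frac{q^2}{\rho}\Big)+\partial_x(\varepsilon p(\rho))=0,$$ with Riemann data $(\rho_\ell^\varepsilon,q_\ell^\varepsilon)$ for $x<0$ and $(\rho_r^\varepsilon,q_r^\varepsilon)$ for $x\ge 0$, where $(\rho_\ell^\varepsilon,q_\ell^\varepsilon)\to(\rho_\ell,q_\ell)$ and $(\rho_r^\varepsilon,q_r^\varepsilon)\to(\rho_r,q_r)$ as $\varepsilon\to0^+$, and $0<\rho_\ell<\rho^*$, $0<\rho_r<\rho^*$ (so that $\varepsilon p(\rho^\varepsilon_{\ell})\to 0$ and $\varepsilon p(\rho^\varepsilon_{r})\to0$). Put $u_\ell=q_\ell/\rho_\ell$, $u_r=q_r/\rho_r$. A solution of the Riemann problem is a self-similar function $(\rho^\varepsilon,q^\varepsilon)(x/t)$ that consists of the left state, a wave of the first family, an intermediate state $(\tilde\rho^\varepsilon,\tilde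 q^\varepsilon)$ (possibly the vacuum $(0,0)$), a wave of the second family, and the right state; each wave is a rarefaction wave or a shock satisfying the Rankine–Hugoniot conditions and the Lax entropy inequalities (or is absent). For all small $\varepsilon>0$ the Riemann problem has such a solution. As $\varepsilon\to0^+$, for any choice of these solutions, $(\rho^\varepsilon,q^\varepsilon,\varepsilon p(\rho^\varepsilon))$, as a function of $\xi=x/t$, converges uniformly away from any neighbourhood of the discontinuities of the following limits, which are made of waves of the limit system $\partial_t\rho+\partial_xq=0$, $\partial_tq+\partial_x(q^2/\rho)+\partial_x\bar p=0$, $(\rho-\rho^*)\bar p=0$, $0\le\rho\le\rho^*$, $\bar p\ge0$. (A contact wave is a discontinuity that moves at the fluid velocity, with no jump of the pressure; a shock is a discontinuity that satisfies the Rankine–Hugoniot conditions and is crossed by the fluid.) 1. If $u_\ell<u_r$, then $(\tilde\rho^\varepsilon,\tilde q^\varepsilon,\varepsilon p(\tilde\rho^\varepsilon))\to(0,0,0)$ and the limit consists of two contact waves, of speeds $u_\ell$ and $u_r$, connecting the two states to the vacuum: $$(\rho_\ell,q_\ell,0)\xrightarrow{\text{contact}}(0,0,0)\xrightarrow{\text{contact}}(\rho_r,q_r,0).$$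 2. If $u_\ell>u_r$, then the limit consists of two shock waves around a congested state, $$(\rho_\ell,q_\ell,0)\xrightarrow{\text{shock}}(\rho^*,\tilde q,\bar p)\xrightarrow{\text{shock}}(\rho_r,q_r,0),$$ where $$\bar p=(u_\ell-u_r)^2\left(\sqrt{\frac{\rho^*-\rho_\ell}{\rho_\ell\rho^*}}+\sqrt{\frac{\rho^*-\rho_r}{\rho_r\rho^*}}\right)^{-2}>0,$$ $$\tilde q=u_\ell\rho^*-\sqrt{\frac{\rho^*}{\rho_\ell}}\sqrt{(\rho^*-\rho_\ell)\bar p}=u_r\rho^*+\sqrt{\frac{\rho^*}{\rho_r}}\sqrt{(\rho^*-\rho_r)\bar p},$$ and the shock speeds are $$\sigma_-=u_\ell-\sqrt{\frac{\rho^*}{\rho_\ell(\rho^*-\rho_\ell)}}\sqrt{\bar p}\;<\;\sigma_+=u_r+\sqrt{\frac{\rho^*}{\rho_r(\rho^*-\rho_r)}}\sqrt{\bar p}.$$ Moreover, for small $\varepsilon$ both waves of the solution are shocks, their speeds converge to $\sigma_-$ and $\sigma_+$, and $(\tilde\rho^\varepsilon,\tilde q^\varepsilon,\varepsilon p(\tilde\rho^\varepsilon))\to(\rho^*,\tilde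 q,\bar p)$. 3. If $u_\ell=u_r$, then the limit consists of a single contact wave, of speed $u_\ell=u_r$: $$(\rho_\ell,q_\ell,0)\xrightarrow{\text{contact}}(\rho_r,q_r,0).$$ -/

import Mathlib

open Filter Topology

noncomputable section

/-- The singular pressure `p(ρ) = 1 / (1/ρ - 1/ρ*)^γ` for `0 < ρ < ρ*`, extended by its limit
`p(0) = 0` to the vacuum. -/
def pressure (γ ρs ρ : ℝ) : ℝ :=
  if ρ = 0 then 0 else 1 / (1 / ρ - 1 / ρs) ^ γ

/-- The momentum flux `q² / ρ + ε p(ρ)` of a state `U = (ρ, q)` (it is `0` at the vacuum `(0, 0)`). -/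
def momentumFlux (γ ρs ε : ℝ) (U : ℝ × ℝ) : ℝ :=
  U.2 ^ 2 / U.1 + ε * pressure γ ρs U.1

/-- The characteristic speed `u + s √(ε p'(ρ))` with `u = q / ρ`; the first family is `s = -1` and the
second one is `s = 1`. -/
def charSpeed (γ ρs ε s : ℝ) (U : ℝ × ℝ) : ℝ :=
  U.2 / U.1 + s * √(ε * deriv (pressure γ ρs) U.1)

/-- An entropic shock of the family `s`, travelling at speed `σ`, from the left state `L` to the right
state `R`: the Rankine-Hugoniot conditions and the Lax entropy inequalities. -/
structure IsShock (γ ρs ε s σ : ℝ) (L R : ℝ × ℝ) : Prop where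
  left_mem : L.1 ∈ Set.Ioo 0 ρs
  right_mem : R.1 ∈ Set.Ioo 0 ρs
  mass : R.2 - L.2 = σ * (R.1 - L.1)
  momentum : momentumFlux γ ρs ε R - momentumFlux γ ρs ε L = σ * (R.2 - L.2)
  lax_right : charSpeed γ ρs ε s R < σ
  lax_left : σ < charSpeed γ ρs ε s L

/-- The profile `W` (as a function of `ξ = x / t`) is, on `[a, b]`, a rarefaction wave of the family
`s` from `L` to `R`: it is continuous, takes the values `L` and `R` at the ends, and inside it has
positive density, its characteristic speed is `ξ`, and `W'(ξ)` is a multiple of the eigenvector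
`(1, u + s √(ε p'(ρ))) = (1, ξ)`. One of the end states may be the vacuum; `a = b` means that
there is no wave. -/
structure IsRarefaction (γ ρs ε s a b : ℝ) (L R : ℝ × ℝ) (W : ℝ → ℝ × ℝ) : Prop where
  le : a ≤ b
  cont : ContinuousOn W (Set.Icc a b)
  left_val : W a = L
  right_val : W b = R
  density_mem : ∀ ξ ∈ Set.Ioo a b, (W ξ).1 ∈ Set.Ioo 0 ρs
  speed : ∀ ξ ∈ Set.Ioo a b, charSpeed γ ρs ε s (W ξ) = ξ
  integral_curve : ∀ ξ ∈ Set.Ioo a b, ∃ r : ℝ, HasDerivAt W (r • ((1 : ℝ), ξ)) ξ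

/-- A self-similar function `(ρ, q)(x, t) = profile (x / t)`, with an intermediate state `mid`, a first
wave occupying `a₁ ≤ x / t ≤ b₁` and a second wave occupying `a₂ ≤ x / t ≤ b₂`. -/
structure WaveFan where
  profile : ℝ → ℝ × ℝ
  mid : ℝ × ℝ
  a₁ : ℝ
  b₁ : ℝ
  a₂ : ℝ
  b₂ : ℝ

/-- `F` is a solution of the Riemann problem with states `L`, `R` for the system
`∂ₜ ρ + ∂ₓ q = 0`, `∂ₜ q + ∂ₓ (q² / ρ) + ∂ₓ (ε p(ρ)) = 0`: constant states `L`, `mid`, `R` separated by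
a wave of the first family and a wave of the second family, each of them an entropic shock or a
rarefaction (possibly trivial). The intermediate state may be the vacuum. -/
structure IsRiemannSolution (γ ρs ε : ℝ) (L R : ℝ × ℝ) (F : WaveFan) : Prop where
  mid_mem : F.mid.1 ∈ Set.Ioo 0 ρs ∨ F.mid = (0, 0)
  order : F.b₁ ≤ F.a₂
  left_const : ∀ ξ < F.a₁, F.profile ξ = L
  mid_const : ∀ ξ ∈ Set.Ioo F.b₁ F.a₂, F.profile ξ = F.mid
  right_const : ∀ ξ > F.b₂, F.profile ξ = R
  first_wave :
    (F.a₁ = F.b₁ ∧ IsShock γ ρs ε (-1) F.a₁ L F.mid) ∨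
    (F.a₁ = charSpeed γ ρs ε (-1) L ∧ IsRarefaction γ ρs ε (-1) F.a₁ F.b₁ L F.mid F.profile)
  second_wave :
    (F.a₂ = F.b₂ ∧ IsShock γ ρs ε 1 F.a₂ F.mid R) ∨
    (F.b₂ = charSpeed γ ρs ε 1 R ∧ IsRarefaction γ ρs ε 1 F.a₂ F.b₂ F.mid R F.profile)

/-- The triple `(ρ, q, ε p(ρ))`. -/
def fullState (γ ρs ε : ℝ) (U : ℝ × ℝ) : ℝ × ℝ × ℝ :=
  (U.1, U.2, ε * pressure γ ρs U.1)

/-- As `ε → 0⁺`, the triples `(ρ, q, ε p(ρ))` of the fans `F ε`, as functions of `ξ = x / t`, converge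
to `V` uniformly away from the finitely many speeds in `J`. -/
def ConvergesAwayFrom (γ ρs : ℝ) (F : ℝ → WaveFan) (V : ℝ → ℝ × ℝ × ℝ) (J : Finset ℝ) : Prop :=
  ∀ δ > 0, TendstoUniformlyOn (fun ε ξ => fullState γ ρs ε ((F ε).profile ξ)) V (𝓝[>] 0)
    {ξ | ∀ s ∈ J, δ ≤ |ξ - s|}

/-- One discontinuity, at `x / t = s`, between two constant states. -/
def oneJump (s : ℝ) (A B : ℝ × ℝ × ℝ) (ξ : ℝ) : ℝ × ℝ × ℝ :=
  if ξ < s then A else B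

/-- Two discontinuities, at `x / t = s₁` and `x / t = s₂`, between three constant states. -/
def twoJumps (s₁ s₂ : ℝ) (A M B : ℝ × ℝ × ℝ) (ξ : ℝ) : ℝ × ℝ × ℝ :=
  if ξ < s₁ then A else if ξ < s₂ then M else B

/-- The triples `(ρ, q, p̄)` admitted by the limit system: `0 ≤ ρ ≤ ρ*`, `p̄ ≥ 0`, the constraint
`(ρ - ρ*) p̄ = 0`, and no momentum in the vacuum. -/
structure IsLimitState (ρs : ℝ) (A : ℝ × ℝ × ℝ) : Prop where
  density_nonneg : 0 ≤ A.1
  density_le : A.1 ≤ ρs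
  pressure_nonneg : 0 ≤ A.2.2
  constraint : (A.1 - ρs) * A.2.2 = 0
  vacuum : A.1 = 0 → A.2.1 = 0

/-- A discontinuity of speed `s` of the limit system `∂ₜ ρ + ∂ₓ q = 0`,
`∂ₜ q + ∂ₓ (q² / ρ) + ∂ₓ p̄ = 0`, `(ρ - ρ*) p̄ = 0`: the Rankine-Hugoniot conditions. -/
structure IsLimitDiscontinuity (ρs s : ℝ) (A B : ℝ × ℝ × ℝ) : Prop where
  left_state : IsLimitState ρs A
  right_state : IsLimitState ρs B
  mass : B.2.1 - A.2.1 = s * (B.1 - A.1)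
  momentum : (B.2.1 ^ 2 / B.1 + B.2.2) - (A.2.1 ^ 2 / A.1 + A.2.2) = s * (B.2.1 - A.2.1)

/-- A contact wave of the limit system: it moves with the fluid on both sides (`q = ρ s`) and the
pressure does not jump. -/
structure IsContactWave (ρs s : ℝ) (A B : ℝ × ℝ × ℝ) : Prop extends
    IsLimitDiscontinuity ρs s A B where
  left_velocity : A.2.1 = A.1 * s
  right_velocity : B.2.1 = B.1 * s
  pressure_eq : A.2.2 = B.2.2

/-- A shock wave of the limit system: a discontinuity that is crossed by the fluid. -/
structure IsLimitShock (ρs s : ℝ) (A B : ℝ × ℝ × ℝ) : Prop extends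
    IsLimitDiscontinuity ρs s A B where
  ne : A ≠ B
  left_flux : A.2.1 - s * A.1 ≠ 0
  right_flux : B.2.1 - s * B.1 ≠ 0

/-- The pressure `p̄` of the congested intermediate state. -/
def congestedPressure (ρs ρl ul ρr ur : ℝ) : ℝ :=
  (ul - ur) ^ 2 *
    (√((ρs - ρl) / (ρl * ρs)) + √((ρs - ρr) / (ρr * ρs))) ^ (-2 : ℤ)

end

/-! Everything is governed by the excess volume `w = 1/ρ - 1/ρ*`: the pressure is `w ^ (-γ)` and the
Lagrangian sound speed is `√ε g(w)`, with `g = lagSpeed γ` decreasing. A rarefaction changes the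
velocity by `√ε` times a difference of the primitive of `g`, so it can have strength of order one
only if `w → ∞`, which is vacuum. A shock changes the velocity by the root of the jump of `ε p`
times the drop of `w`, so it can have strength of order one only if `ε p` stays of order one, which
forces `w → 0`, the congested state. The reflection `x ↦ -x` exchanges the two families, so only
waves of the first family are analysed.

Existence at fixed `ε` (`exists_isRiemannSolution`): along the two wave curves, parametrised by the
intermediate `w`, the total change of velocity is continuous and arbitrarily negative near `w = 0`.
Either it attains the prescribed value, or the primitive of `g` is bounded and both fans reach the
vacuum. No case distinction on `γ` is needed.

Limits. If `u_ℓ < u_r`, the intermediate excess volume eventually exceeds any fixed `V`, and the fan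
is dilute outside layers of width `O(√ε)` at its outer edges (`IsRiemannSolution.dilute`). If `u_ℓ >
u_r`, both waves are shocks (`IsRiemannSolution.first_isShock` and its mirror image), `w → 0` in the
middle, and the limit pressure is forced by `u_ℓ - u_r = √p̄ (√w_ℓ + √w_r)`
(`tendsto_mid_of_shocks`). If `u_ℓ = u_r`, both outer edges tend to the common velocity
(`IsRiemannSolution.abs_sub_le`); the fan shrinks to a point and nothing need be known about its
middle. -/

/-- The excess `1/ρ - 1/ρ*` of the specific volume over its minimal value. -/
noncomputable def excessVolume (ρs ρ : ℝ) : ℝ := 1 / ρ - 1 / ρs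

/-- The Lagrangian sound speed `√(-p'(w))` of the pressure law `p = w ^ (-γ)`. -/
noncomputable def lagSpeed (γ w : ℝ) : ℝ := √γ * w ^ (-(γ + 1) / 2)

/-- A primitive of the Lagrangian sound speed. -/
noncomputable def lagPrimitive (γ w : ℝ) : ℝ := ∫ x in (1 : ℝ)..w, lagSpeed γ x

/-- The characteristic speed along a rarefaction curve of the first family, for `ε = 1` and up to an
additive constant. -/
noncomputable def fanSpeed (γ ρs w : ℝ) : ℝ := lagPrimitive γ w - (w + 1 / ρs) * lagSpeed γ w

/-! ### Calculus of the excess volume, the sound speed and the fan speed. -/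

lemma excessVolume_pos {ρs ρ : ℝ} (h : ρ ∈ Set.Ioo 0 ρs) : 0 < excessVolume ρs ρ := by
  have := one_div_lt_one_div_of_lt h.1 h.2
  unfold excessVolume; linarith

lemma excessVolume_add (ρs ρ : ℝ) : excessVolume ρs ρ + 1 / ρs = 1 / ρ := by
  unfold excessVolume; ring

lemma excessVolume_one_div (ρs w : ℝ) : excessVolume ρs (1 / (w + 1 / ρs)) = w := by
  unfold excessVolume; rw [one_div_one_div]; ring

lemma one_div_add_mem_Ioo {ρs w : ℝ} (hρs : 0 < ρs) (hw : 0 < w) :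
    1 / (w + 1 / ρs) ∈ Set.Ioo 0 ρs := by
  have h1 : 0 < 1 / ρs := by positivity
  refine ⟨by positivity, ?_⟩
  rw [div_lt_iff₀ (by positivity), mul_add, mul_one_div_cancel hρs.ne']
  nlinarith

lemma continuousAt_excessVolume {ρs ρ : ℝ} (h : ρ ≠ 0) : ContinuousAt (excessVolume ρs) ρ := by
  unfold excessVolume
  exact (continuousAt_const.div continuousAt_id h).sub continuousAt_const

lemma lagSpeed_pos {γ w : ℝ} (hγ : 0 < γ) (hw : 0 < w) : 0 < lagSpeed γ w := by
  unfold lagSpeed; positivity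

lemma lagSpeed_sq {γ w : ℝ} (hγ : 0 < γ) (hw : 0 < w) :
    lagSpeed γ w ^ 2 = γ * w ^ (-γ - 1) := by
  unfold lagSpeed
  rw [mul_pow, Real.sq_sqrt hγ.le, ← Real.rpow_natCast, ← Real.rpow_mul hw.le]
  congr 2; push_cast; ring

lemma lagSpeed_strictAntiOn {γ : ℝ} (hγ : 0 < γ) : StrictAntiOn (lagSpeed γ) (Set.Ioi 0) := by
  intro x hx y _ hxy
  unfold lagSpeed
  exact mul_lt_mul_of_pos_left (Real.rpow_lt_rpow_of_neg hx hxy (by linarith))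
    (Real.sqrt_pos.2 hγ)

lemma hasDerivAt_lagSpeed {γ w : ℝ} (hw : 0 < w) :
    HasDerivAt (lagSpeed γ) (√γ * ((-(γ + 1) / 2) * w ^ (-(γ + 1) / 2 - 1))) w :=
  (Real.hasDerivAt_rpow_const (Or.inl hw.ne')).const_mul _

lemma continuousAt_lagSpeed {γ w : ℝ} (hw : 0 < w) : ContinuousAt (lagSpeed γ) w :=
  (hasDerivAt_lagSpeed hw).continuousAt

lemma continuousOn_lagSpeed (γ : ℝ) : ContinuousOn (lagSpeed γ) (Set.Ioi 0) :=
  fun _ hw => (continuousAt_lagSpeed hw).continuousWithinAt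

lemma hasDerivAt_lagPrimitive {γ w : ℝ} (hw : 0 < w) :
    HasDerivAt (lagPrimitive γ) (lagSpeed γ w) w := by
  have hsub : Set.uIcc 1 w ⊆ Set.Ioi 0 := fun x hx =>
    lt_of_lt_of_le (lt_min one_pos hw) hx.1
  refine intervalIntegral.integral_hasDerivAt_right
    ((continuousOn_lagSpeed γ).mono hsub).intervalIntegrable ?_ (continuousAt_lagSpeed hw)
  exact (continuousOn_lagSpeed γ).stronglyMeasurableAtFilter isOpen_Ioi w hw

lemma continuousAt_lagPrimitive {γ w : ℝ} (hw : 0 < w) : ContinuousAt (lagPrimitive γ) w :=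
  (hasDerivAt_lagPrimitive hw).continuousAt

lemma lagPrimitive_strictMonoOn {γ : ℝ} (hγ : 0 < γ) :
    StrictMonoOn (lagPrimitive γ) (Set.Ioi 0) := by
  refine strictMonoOn_of_deriv_pos (convex_Ioi 0)
    (fun w hw => (continuousAt_lagPrimitive hw).continuousWithinAt) fun w hw => ?_
  rw [interior_Ioi] at hw
  rw [(hasDerivAt_lagPrimitive hw).deriv]
  exact lagSpeed_pos hγ hw

/-- The two terms in `g` cancel and leave `-(w + 1/ρs) g'(w)`. Its positivity is the genuine
nonlinearity of the family. -/
lemma hasDerivAt_fanSpeed {γ ρs w : ℝ} (hw : 0 < w) :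
    HasDerivAt (fanSpeed γ ρs)
      ((w + 1 / ρs) * (√γ * ((γ + 1) / 2 * w ^ (-(γ + 1) / 2 - 1)))) w := by
  have h := (hasDerivAt_lagPrimitive (γ := γ) hw).sub
    (((hasDerivAt_id w).add_const (1 / ρs)).mul (hasDerivAt_lagSpeed (γ := γ) hw))
  refine h.congr_deriv ?_
  simp only [id]
  ring

lemma fanSpeed_deriv_pos {γ ρs w : ℝ} (hγ : 0 < γ) (hρs : 0 < ρs) (hw : 0 < w) :
    0 < (w + 1 / ρs) * (√γ * ((γ + 1) / 2 * w ^ (-(γ + 1) / 2 - 1))) := by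
  positivity

lemma fanSpeed_strictMonoOn {γ ρs : ℝ} (hγ : 0 < γ) (hρs : 0 < ρs) :
    StrictMonoOn (fanSpeed γ ρs) (Set.Ioi 0) := by
  refine strictMonoOn_of_deriv_pos (convex_Ioi 0)
    (fun w hw => (hasDerivAt_fanSpeed hw).continuousAt.continuousWithinAt) fun w hw => ?_
  rw [interior_Ioi] at hw
  rw [(hasDerivAt_fanSpeed hw).deriv]
  exact fanSpeed_deriv_pos hγ hρs hw

/-! ### Pressure and characteristic speeds in Lagrangian form. -/

lemma pressure_eq {γ ρs ρ : ℝ} (h : ρ ∈ Set.Ioo 0 ρs) :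
    pressure γ ρs ρ = excessVolume ρs ρ ^ (-γ) := by
  rw [pressure, if_neg h.1.ne', Real.rpow_neg (excessVolume_pos h).le, one_div,
    excessVolume]

lemma deriv_pressure {γ ρs ρ : ℝ} (h : ρ ∈ Set.Ioo 0 ρs) :
    deriv (pressure γ ρs) ρ = γ * excessVolume ρs ρ ^ (-γ - 1) / ρ ^ 2 := by
  have hev : pressure γ ρs =ᶠ[𝓝 ρ] fun x => excessVolume ρs x ^ (-γ) := by
    filter_upwards [isOpen_Ioo.mem_nhds h] with x hx using pressure_eq hx
  have h1 : HasDerivAt (excessVolume ρs) (-(ρ ^ 2)⁻¹) ρ := by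
    have := (hasDerivAt_inv h.1.ne').sub_const (1 / ρs)
    refine this.congr_of_eventuallyEq (Eventually.of_forall fun x => ?_)
    simp [excessVolume]
  rw [hev.deriv_eq, (h1.rpow_const (Or.inl (excessVolume_pos h).ne')).deriv]
  ring

/-- The characteristic speeds in terms of the Lagrangian sound speed. -/
lemma charSpeed_eq {γ ρs ε : ℝ} (hγ : 0 < γ) (hε : 0 < ε) (s : ℝ) {U : ℝ × ℝ}
    (h : U.1 ∈ Set.Ioo 0 ρs) :
    charSpeed γ ρs ε s U = U.2 / U.1 + s * (√ε * lagSpeed γ (excessVolume ρs U.1) / U.1) := by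
  have hw := excessVolume_pos h
  have h1 := h.1
  rw [charSpeed, deriv_pressure h, ← lagSpeed_sq hγ hw, ← div_pow, Real.sqrt_mul hε.le,
    Real.sqrt_sq (div_pos (lagSpeed_pos hγ hw) h1).le, mul_div_assoc]

/-! ### Reflection symmetry between the two families. -/

/-- The mirror image of a state. -/
def mirror (U : ℝ × ℝ) : ℝ × ℝ := (U.1, -U.2)

@[simp] lemma mirror_fst (U : ℝ × ℝ) : (mirror U).1 = U.1 := rfl
@[simp] lemma mirror_snd (U : ℝ × ℝ) : (mirror U).2 = -U.2 := rfl
@[simp] lemma mirror_mirror (U : ℝ × ℝ) : mirror (mirror U) = U := by simp [mirror]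

lemma continuous_mirror : Continuous mirror := by unfold mirror; fun_prop

lemma charSpeed_mirror (γ ρs ε s : ℝ) (U : ℝ × ℝ) :
    charSpeed γ ρs ε (-s) (mirror U) = -charSpeed γ ρs ε s U := by
  simp [charSpeed]; ring

lemma IsShock.mirror {γ ρs ε s σ : ℝ} {L R : ℝ × ℝ} (h : IsShock γ ρs ε s σ L R) :
    IsShock γ ρs ε (-s) (-σ) (mirror R) (mirror L) where
  left_mem := h.right_mem
  right_mem := h.left_mem
  mass := by simp; linarith [h.mass]
  momentum := by
    have := h.momentum
    simp only [momentumFlux, mirror_fst, mirror_snd, neg_sq] at this ⊢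
    linarith
  lax_right := by rw [charSpeed_mirror]; linarith [h.lax_left]
  lax_left := by rw [charSpeed_mirror]; linarith [h.lax_right]

lemma IsRarefaction.mirror {γ ρs ε s a b : ℝ} {L R : ℝ × ℝ} {W : ℝ → ℝ × ℝ}
    (h : IsRarefaction γ ρs ε s a b L R W) :
    IsRarefaction γ ρs ε (-s) (-b) (-a) (mirror R) (mirror L) (fun ξ => mirror (W (-ξ))) where
  le := neg_le_neg h.le
  cont := by
    refine continuous_mirror.comp_continuousOn (h.cont.comp continuous_neg.continuousOn ?_)
    intro ξ hξ
    exact ⟨by linarith [hξ.2], by linarith [hξ.1]⟩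
  left_val := by simp [h.right_val]
  right_val := by simp [h.left_val]
  density_mem ξ hξ := h.density_mem (-ξ) ⟨by linarith [hξ.2], by linarith [hξ.1]⟩
  speed ξ hξ := by
    rw [charSpeed_mirror, h.speed (-ξ) ⟨by linarith [hξ.2], by linarith [hξ.1]⟩, neg_neg]
  integral_curve ξ hξ := by
    obtain ⟨r, hr⟩ := h.integral_curve (-ξ) ⟨by linarith [hξ.2], by linarith [hξ.1]⟩
    have h1 := hr.scomp ξ (hasDerivAt_neg ξ)
    have hf := h1.hasFDerivAt.fst.hasDerivAt
    have hs := h1.hasFDerivAt.snd.neg.hasDerivAt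
    refine ⟨-r, (hf.prodMk hs).congr_deriv ?_⟩
    simp

/-- A wave of the first family from `L` to `M`, occupying `[a, b]`. -/
def IsFirstWave (γ ρs ε a b : ℝ) (L M : ℝ × ℝ) (W : ℝ → ℝ × ℝ) : Prop :=
  (a = b ∧ IsShock γ ρs ε (-1) a L M) ∨
    (a = charSpeed γ ρs ε (-1) L ∧ IsRarefaction γ ρs ε (-1) a b L M W)

/-- The mirror image of a wave fan. -/
def WaveFan.mirror (F : WaveFan) : WaveFan where
  profile ξ := _root_.mirror (F.profile (-ξ))
  mid := _root_.mirror F.mid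
  a₁ := -F.b₂
  b₁ := -F.a₂
  a₂ := -F.b₁
  b₂ := -F.a₁

lemma IsRiemannSolution.mirror {γ ρs ε : ℝ} {L R : ℝ × ℝ} {F : WaveFan}
    (h : IsRiemannSolution γ ρs ε L R F) :
    IsRiemannSolution γ ρs ε (mirror R) (mirror L) F.mirror where
  mid_mem := by
    rcases h.mid_mem with hm | hm
    · exact Or.inl hm
    · right; simp [WaveFan.mirror, hm, _root_.mirror]
  order := neg_le_neg h.order
  left_const ξ hξ := congrArg _root_.mirror (h.right_const (-ξ) (lt_neg.1 hξ))
  mid_const ξ hξ := congrArg _root_.mirror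
    (h.mid_const (-ξ) ⟨lt_neg.1 hξ.2, neg_lt.1 hξ.1⟩)
  right_const ξ hξ := congrArg _root_.mirror (h.left_const (-ξ) (neg_lt.1 hξ))
  first_wave := by
    rcases h.second_wave with ⟨h1, h2⟩ | ⟨h1, h2⟩
    · left
      refine ⟨neg_inj.2 h1.symm, ?_⟩
      have := h2.mirror
      rw [h1] at this
      exact this
    · right
      exact ⟨by rw [charSpeed_mirror, ← h1]; rfl, h2.mirror⟩
  second_wave := by
    rcases h.first_wave with ⟨h1, h2⟩ | ⟨h1, h2⟩
    · left
      refine ⟨neg_inj.2 h1.symm, ?_⟩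
      have := h2.mirror
      rw [h1, neg_neg] at this
      exact this
    · right
      refine ⟨?_, ?_⟩
      · have := charSpeed_mirror γ ρs ε (-1) L
        rw [neg_neg] at this
        rw [this, ← h1]; rfl
      · have := h2.mirror
        rw [neg_neg] at this
        exact this

/-! ### Necessary relations across shocks and rarefactions of the first family. -/

/-- The relations across a shock of the first family; `m` is the mass flux through it. -/
lemma IsShock.exists_flux {γ ρs ε σ : ℝ} {L R : ℝ × ℝ} (hγ : 0 < γ) (hε : 0 < ε)
    (h : IsShock γ ρs ε (-1) σ L R) :
    ∃ m : ℝ, 0 < m ∧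
      m ^ 2 * (excessVolume ρs L.1 - excessVolume ρs R.1) =
        ε * excessVolume ρs R.1 ^ (-γ) - ε * excessVolume ρs L.1 ^ (-γ) ∧
      R.2 / R.1 = L.2 / L.1 - m * (excessVolume ρs L.1 - excessVolume ρs R.1) ∧
      σ = L.2 / L.1 - m / L.1 ∧ m < √ε * lagSpeed γ (excessVolume ρs R.1) ∧
      excessVolume ρs R.1 < excessVolume ρs L.1 := by
  have hL := h.left_mem.1
  have hR := h.right_mem.1
  have hwL := excessVolume_pos h.left_mem
  have hwR := excessVolume_pos h.right_mem
  have hmass := h.mass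
  have hmom := h.momentum
  have h1 := h.lax_right
  have h2 := h.lax_left
  rw [charSpeed_eq hγ hε _ h.right_mem] at h1
  rw [charSpeed_eq hγ hε _ h.left_mem] at h2
  simp only [momentumFlux, pressure_eq h.left_mem, pressure_eq h.right_mem] at hmom
  set m := L.2 - σ * L.1 with hm
  have hLq : L.2 = m + σ * L.1 := by rw [hm]; ring
  have hRq : R.2 = m + σ * R.1 := by rw [hm]; linarith
  have huL : L.2 / L.1 = m / L.1 + σ := by rw [hLq]; field_simp
  have huR : R.2 / R.1 = m / R.1 + σ := by rw [hRq]; field_simp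
  have h1' : m < √ε * lagSpeed γ (excessVolume ρs R.1) := by
    rw [huR] at h1
    have : m / R.1 < √ε * lagSpeed γ (excessVolume ρs R.1) / R.1 := by linarith
    exact (div_lt_div_iff_of_pos_right hR).1 this
  have h2' : √ε * lagSpeed γ (excessVolume ρs L.1) < m := by
    rw [huL] at h2
    have : √ε * lagSpeed γ (excessVolume ρs L.1) / L.1 < m / L.1 := by linarith
    exact (div_lt_div_iff_of_pos_right hL).1 this
  have hsε := Real.sqrt_pos.2 hε
  have hdv : excessVolume ρs L.1 - excessVolume ρs R.1 = 1 / L.1 - 1 / R.1 := by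
    unfold excessVolume; ring
  refine ⟨m, (mul_pos hsε (lagSpeed_pos hγ hwL)).trans h2', ?_, ?_, by linarith, h1', ?_⟩
  · have eL : L.2 ^ 2 / L.1 = m ^ 2 * (1 / L.1) + 2 * m * σ + σ ^ 2 * L.1 := by
      rw [hLq]; field_simp; ring
    have eR : R.2 ^ 2 / R.1 = m ^ 2 * (1 / R.1) + 2 * m * σ + σ ^ 2 * R.1 := by
      rw [hRq]; field_simp; ring
    rw [eL, eR, hRq, hLq] at hmom
    rw [hdv]
    linarith
  · rw [hdv, huL, huR]; ring
  -- The Lax inequalities enclose `m` between `√ε g` at the left and `√ε g` at the right; since `g`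
  -- decreases, the shock is compressive.
  · have h3 := lt_of_mul_lt_mul_left (h2'.trans h1') hsε.le
    exact ((lagSpeed_strictAntiOn hγ).lt_iff_gt hwL hwR).1 h3

lemma eq_of_hasDerivAt_zero_Ioo {f : ℝ → ℝ} {a b : ℝ} (hab : a ≤ b)
    (hc : ContinuousOn f (Set.Icc a b)) (hd : ∀ x ∈ Set.Ioo a b, HasDerivAt f 0 x) :
    f b = f a := by
  rcases hab.eq_or_lt with rfl | hlt
  · rfl
  · obtain ⟨c, -, hc'⟩ := exists_hasDerivAt_eq_slope f (fun _ => 0) hlt hc hd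
    have : b - a ≠ 0 := by linarith
    field_simp at hc'
    linarith

/-- The Riemann invariant is constant and the characteristic speed is `ξ` along a rarefaction wave of
the first family, up to its ends as long as these are not the vacuum. -/
lemma IsRarefaction.riemann_invariant {γ ρs ε a b ξ : ℝ} {L M : ℝ × ℝ} {W : ℝ → ℝ × ℝ}
    (hγ : 0 < γ) (hε : 0 < ε) (h : IsRarefaction γ ρs ε (-1) a b L M W)
    (hL : L.1 ∈ Set.Ioo 0 ρs) (ha : a = charSpeed γ ρs ε (-1) L) (hξ : ξ ∈ Set.Icc a b)
    (hW : (W ξ).1 ∈ Set.Ioo 0 ρs) :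
    (W ξ).2 / (W ξ).1 = L.2 / L.1 + √ε * (lagPrimitive γ (excessVolume ρs (W ξ).1) -
      lagPrimitive γ (excessVolume ρs L.1)) ∧ charSpeed γ ρs ε (-1) (W ξ) = ξ := by
  have hmem : ∀ x ∈ Set.Icc a ξ, (W x).1 ∈ Set.Ioo 0 ρs := by
    intro x hx
    rcases hx.1.eq_or_lt with rfl | h1
    · rw [h.left_val]; exact hL
    rcases hx.2.eq_or_lt with rfl | h2
    · exact hW
    · exact h.density_mem x ⟨h1, h2.trans_le hξ.2⟩
  have hWc : ContinuousOn W (Set.Icc a ξ) := h.cont.mono (Set.Icc_subset_Icc_right hξ.2)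
  have hc1 : ContinuousOn (fun x => (W x).1) (Set.Icc a ξ) := continuous_fst.comp_continuousOn hWc
  have hc2 : ContinuousOn (fun x => (W x).2) (Set.Icc a ξ) := continuous_snd.comp_continuousOn hWc
  have hu : ContinuousOn (fun x => (W x).2 / (W x).1) (Set.Icc a ξ) :=
    hc2.div hc1 fun x hx => (hmem x hx).1.ne'
  have hw : ContinuousOn (fun x => excessVolume ρs (W x).1) (Set.Icc a ξ) := fun x hx =>
    (continuousAt_excessVolume (hmem x hx).1.ne').comp_continuousWithinAt
      (f := fun x => (W x).1) (hc1 x hx)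
  have hG : ContinuousOn (fun x => lagPrimitive γ (excessVolume ρs (W x).1)) (Set.Icc a ξ) :=
    fun x hx => (continuousAt_lagPrimitive (excessVolume_pos (hmem x hx))).comp_continuousWithinAt
      (f := fun x => excessVolume ρs (W x).1) (hw x hx)
  have hg : ContinuousOn (fun x => lagSpeed γ (excessVolume ρs (W x).1)) (Set.Icc a ξ) :=
    fun x hx => (continuousAt_lagSpeed (excessVolume_pos (hmem x hx))).comp_continuousWithinAt
      (f := fun x => excessVolume ρs (W x).1) (hw x hx)
  have hIoo : ∀ x ∈ Set.Ioo a ξ, x ∈ Set.Ioo a b := fun x hx => ⟨hx.1, hx.2.trans_le hξ.2⟩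
  constructor
  · have key := eq_of_hasDerivAt_zero_Ioo
      (f := fun x => (W x).2 / (W x).1 - √ε * lagPrimitive γ (excessVolume ρs (W x).1)) hξ.1
      (hu.sub (continuousOn_const.mul hG)) ?_
    · simp only [h.left_val] at key
      linarith
    · intro x hx
      have hx' := hIoo x hx
      obtain ⟨r, hr⟩ := h.integral_curve x hx'
      have hm := h.density_mem x hx'
      have hne := hm.1.ne'
      have hf : HasDerivAt (fun x => (W x).1) r x := by
        simpa using hr.hasFDerivAt.fst.hasDerivAt
      have hs : HasDerivAt (fun x => (W x).2) (r * x) x := by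
        simpa using hr.hasFDerivAt.snd.hasDerivAt
      have hsp := h.speed x hx'
      rw [charSpeed_eq hγ hε _ hm] at hsp
      have he : HasDerivAt (fun x => excessVolume ρs (W x).1) (-r / (W x).1 ^ 2) x := by
        refine ((hf.inv hne).sub_const (1 / ρs)).congr_of_eventuallyEq
          (Eventually.of_forall fun y => ?_)
        simp [excessVolume]
      have hp := (hasDerivAt_lagPrimitive (γ := γ) (excessVolume_pos hm)).comp x he
      refine ((hs.div hf hne).sub (hp.const_mul √ε)).congr_deriv ?_
      -- Since `q' = x ρ'` and `x ρ = q - √ε g(w)`, the derivative of `q / ρ` is `-√ε g(w) ρ' / ρ²`,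
      -- which is that of `√ε` times the primitive at `w`.
      have hxr : x * (W x).1 = (W x).2 - √ε * lagSpeed γ (excessVolume ρs (W x).1) := by
        nth_rewrite 1 [← hsp]; field_simp; ring
      rw [show r * x * (W x).1 = r * (x * (W x).1) by ring, hxr]
      field_simp
      ring
  -- The characteristic speed minus `x` vanishes inside the wave; continuity carries this to the end
  -- `ξ`, where the density is positive.
  · have key := eq_of_hasDerivAt_zero_Ioo
      (f := fun x => (W x).2 / (W x).1 +
        -1 * (√ε * lagSpeed γ (excessVolume ρs (W x).1) / (W x).1) - x) hξ.1
      ((hu.add (continuousOn_const.mul ((continuousOn_const.mul hg).div hc1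
        fun x hx => (hmem x hx).1.ne'))).sub continuousOn_id) ?_
    · simp only [h.left_val] at key
      rw [charSpeed_eq hγ hε _ hL] at ha
      rw [charSpeed_eq hγ hε _ hW]
      linarith
    · intro x hx
      refine (hasDerivAt_const x (0 : ℝ)).congr_of_eventuallyEq ?_
      filter_upwards [isOpen_Ioo.mem_nhds hx] with y hy
      have := h.speed y (hIoo y hy)
      rw [charSpeed_eq hγ hε _ (h.density_mem y (hIoo y hy))] at this
      linarith

/-- Inserting the Riemann invariant into the characteristic speed eliminates the velocity, so `ξ`
depends on `w` alone. As `ξ ≥ a` and the fan speed is increasing, rarefactions expand the fluid. -/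
lemma IsRarefaction.fanSpeed_sub {γ ρs ε a b ξ : ℝ} {L M : ℝ × ℝ} {W : ℝ → ℝ × ℝ}
    (hγ : 0 < γ) (hε : 0 < ε) (h : IsRarefaction γ ρs ε (-1) a b L M W)
    (hL : L.1 ∈ Set.Ioo 0 ρs) (ha : a = charSpeed γ ρs ε (-1) L) (hξ : ξ ∈ Set.Icc a b)
    (hW : (W ξ).1 ∈ Set.Ioo 0 ρs) :
    ξ - a = √ε * (fanSpeed γ ρs (excessVolume ρs (W ξ).1) -
      fanSpeed γ ρs (excessVolume ρs L.1)) ∧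
    (W ξ).2 = (W ξ).1 * ξ + √ε * lagSpeed γ (excessVolume ρs (W ξ).1) ∧
    excessVolume ρs L.1 ≤ excessVolume ρs (W ξ).1 := by
  obtain ⟨h1, h2⟩ := h.riemann_invariant hγ hε hL ha hξ hW
  rw [charSpeed_eq hγ hε _ hW] at h2
  rw [charSpeed_eq hγ hε _ hL] at ha
  have h3 : ξ - a = √ε * (fanSpeed γ ρs (excessVolume ρs (W ξ).1) -
      fanSpeed γ ρs (excessVolume ρs L.1)) := by
    simp only [fanSpeed, excessVolume_add]
    rw [ha]
    nth_rewrite 1 [← h2]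
    rw [h1]
    ring
  refine ⟨h3, ?_, ?_⟩
  · have hne := hW.1.ne'
    have h4 : (W ξ).2 / (W ξ).1 =
        ξ + √ε * lagSpeed γ (excessVolume ρs (W ξ).1) / (W ξ).1 := by linarith
    rw [div_eq_iff hne, add_mul, div_mul_cancel₀ _ hne] at h4
    rw [h4, mul_comm ξ]
  · by_contra hlt
    push Not at hlt
    have := fanSpeed_strictMonoOn hγ (hL.1.trans hL.2) (excessVolume_pos hW)
      (excessVolume_pos hL) hlt
    have := mul_pos (Real.sqrt_pos.2 hε) (sub_pos.2 this)
    linarith [hξ.1]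

/-! ### The wave curve of the first family, and its shocks. -/

/-- The secant slope of the pressure law is a squared Lagrangian sound speed. -/
lemma exists_lagSpeed_sq_eq_slope {γ x y : ℝ} (hγ : 0 < γ) (hx : 0 < x) (hxy : x < y) :
    ∃ θ ∈ Set.Ioo x y, x ^ (-γ) - y ^ (-γ) = lagSpeed γ θ ^ 2 * (y - x) := by
  have hpos : ∀ z ∈ Set.Icc x y, 0 < z := fun z hz => hx.trans_le hz.1
  obtain ⟨θ, hθ, h⟩ := exists_hasDerivAt_eq_slope (fun z : ℝ => z ^ (-γ))
    (fun z => -γ * z ^ (-γ - 1)) hxy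
    (fun z hz => (Real.continuousAt_rpow_const z _ (Or.inl (hpos z hz).ne')).continuousWithinAt)
    fun z hz => Real.hasDerivAt_rpow_const (Or.inl (hpos z ⟨hz.1.le, hz.2.le⟩).ne')
  refine ⟨θ, hθ, ?_⟩
  rw [lagSpeed_sq hγ (hx.trans hθ.1)]
  have hne : y - x ≠ 0 := by linarith
  rw [eq_div_iff hne] at h
  linarith

/-- The change of velocity across a wave of the first family, from a state of excess volume `w₀` to
one of excess volume `w`. -/
noncomputable def waveJump (γ ε w₀ w : ℝ) : ℝ :=
  √ε * (lagPrimitive γ (max w w₀) - lagPrimitive γ w₀) -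
    √(ε * ((min w w₀) ^ (-γ) - w₀ ^ (-γ)) * (w₀ - min w w₀))

/-- The truncations by `max` and `min` make each branch vanish on the other side of `w₀`, so a
single formula covers the whole curve. -/
lemma continuousOn_waveJump (γ ε : ℝ) {w₀ : ℝ} (h₀ : 0 < w₀) :
    ContinuousOn (waveJump γ ε w₀) (Set.Ioi 0) := by
  intro w hw
  have hmax : ContinuousAt (fun w => lagPrimitive γ (max w w₀)) w :=
    (continuousAt_lagPrimitive (lt_max_of_lt_right h₀)).comp
      (f := fun w => max w w₀) (by fun_prop)
  have hmin : ContinuousAt (fun w : ℝ => (min w w₀) ^ (-γ)) w :=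
    (Real.continuousAt_rpow_const (min w w₀) (-γ) (Or.inl (lt_min hw h₀).ne')).comp
      (f := fun w => min w w₀) (by fun_prop)
  refine ContinuousAt.continuousWithinAt ?_
  unfold waveJump
  fun_prop

lemma waveJump_of_le {γ ε w₀ w : ℝ} (h : w₀ ≤ w) :
    waveJump γ ε w₀ w = √ε * (lagPrimitive γ w - lagPrimitive γ w₀) := by
  simp [waveJump, max_eq_left h, min_eq_right h]

lemma waveJump_of_ge {γ ε w₀ w : ℝ} (h : w ≤ w₀) :
    waveJump γ ε w₀ w = -√(ε * (w ^ (-γ) - w₀ ^ (-γ)) * (w₀ - w)) := by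
  simp [waveJump, max_eq_right h, min_eq_left h]

/-- The mass flux is `m = √ε g(θ)`, where `θ` is the mean value point of the secant of the pressure
law. As `θ` lies strictly between the two excess volumes and `g` decreases, both Lax inequalities
follow. -/
lemma exists_isShock {γ ρs ε w : ℝ} {L M : ℝ × ℝ} (hγ : 0 < γ) (hε : 0 < ε)
    (hL : L.1 ∈ Set.Ioo 0 ρs) (hM : M.1 ∈ Set.Ioo 0 ρs) (hMw : excessVolume ρs M.1 = w)
    (hw : w < excessVolume ρs L.1)
    (hu : M.2 / M.1 = L.2 / L.1 + waveJump γ ε (excessVolume ρs L.1) w) :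
    ∃ σ, IsShock γ ρs ε (-1) σ L M ∧ σ < M.2 / M.1 := by
  have hw0 : 0 < w := hMw ▸ excessVolume_pos hM
  have hL0 := excessVolume_pos hL
  obtain ⟨θ, hθ, hs⟩ := exists_lagSpeed_sq_eq_slope hγ hw0 hw
  have hθ0 := hw0.trans hθ.1
  have hsε := Real.sqrt_pos.2 hε
  have hgθ := lagSpeed_pos hγ hθ0
  obtain ⟨m, hm⟩ : ∃ m, m = √ε * lagSpeed γ θ := ⟨_, rfl⟩
  have hm0 : 0 < m := hm ▸ mul_pos hsε hgθ
  have hm2 : m ^ 2 = ε * lagSpeed γ θ ^ 2 := by rw [hm, mul_pow, Real.sq_sqrt hε.le]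
  rw [waveJump_of_ge hw.le, hs, show ε * (lagSpeed γ θ ^ 2 * (excessVolume ρs L.1 - w)) *
    (excessVolume ρs L.1 - w) = (m * (excessVolume ρs L.1 - w)) ^ 2 by rw [mul_pow, hm2]; ring,
    Real.sqrt_sq (mul_pos hm0 (sub_pos.2 hw)).le] at hu
  have hv : excessVolume ρs L.1 - w = 1 / L.1 - 1 / M.1 := by
    rw [← hMw]; unfold excessVolume; ring
  have hL1 := hL.1
  have hM1 := hM.1
  set σ := L.2 / L.1 - m / L.1 with hσ
  have hLq : L.2 = m + σ * L.1 := by rw [hσ]; field_simp; ring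
  have huM : M.2 / M.1 = σ + m / M.1 := by rw [hu, hv, hσ]; ring
  have hMq : M.2 = m + σ * M.1 := by
    rw [div_eq_iff hM1.ne'] at huM
    rw [huM]; field_simp; ring
  refine ⟨σ, ⟨hL, hM, by rw [hMq, hLq]; ring, ?_, ?_, ?_⟩, ?_⟩
  · simp only [momentumFlux, pressure_eq hL, pressure_eq hM]
    have eL : L.2 ^ 2 / L.1 = m ^ 2 * (1 / L.1) + 2 * m * σ + σ ^ 2 * L.1 := by
      rw [hLq]; field_simp; ring
    have eR : M.2 ^ 2 / M.1 = m ^ 2 * (1 / M.1) + 2 * m * σ + σ ^ 2 * M.1 := by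
      rw [hMq]; field_simp; ring
    have h3 : ε * w ^ (-γ) - ε * excessVolume ρs L.1 ^ (-γ) = m ^ 2 * (1 / L.1 - 1 / M.1) := by
      rw [← mul_sub, hs, hm2, hv]; ring
    rw [eL, eR, hMw, hMq, hLq]
    linarith
  · rw [charSpeed_eq hγ hε _ hM, huM, hMw]
    have : m / M.1 < √ε * lagSpeed γ w / M.1 := by
      rw [hm]
      exact div_lt_div_of_pos_right
        (mul_lt_mul_of_pos_left (lagSpeed_strictAntiOn hγ hw0 hθ0 hθ.1) hsε) hM1
    linarith
  · rw [charSpeed_eq hγ hε _ hL, hσ]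
    have : √ε * lagSpeed γ (excessVolume ρs L.1) / L.1 < m / L.1 := by
      rw [hm]
      exact div_lt_div_of_pos_right
        (mul_lt_mul_of_pos_left (lagSpeed_strictAntiOn hγ hθ0 hL0 hθ.2) hsε) hL1
    linarith
  · rw [huM]
    have : 0 < m / M.1 := by positivity
    linarith

/-! ### Construction of rarefaction fans. -/

/-- The state of excess volume `w` whose first characteristic speed is `ξ`. -/
noncomputable def fanState (γ ρs ε w ξ : ℝ) : ℝ × ℝ :=
  (1 / (w + 1 / ρs), 1 / (w + 1 / ρs) * ξ + √ε * lagSpeed γ w)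

lemma charSpeed_fanState {γ ρs ε w : ℝ} (hγ : 0 < γ) (hρs : 0 < ρs) (hε : 0 < ε) (hw : 0 < w)
    (ξ : ℝ) : charSpeed γ ρs ε (-1) (fanState γ ρs ε w ξ) = ξ := by
  have hm := one_div_add_mem_Ioo hρs hw
  have hv : (fanState γ ρs ε w ξ).1 = 1 / (w + 1 / ρs) := rfl
  rw [charSpeed_eq hγ hε _ (by rw [hv]; exact hm), hv, excessVolume_one_div]
  have h := hm.1.ne'
  simp only [fanState]
  generalize 1 / (w + 1 / ρs) = ρ at h
  field_simp
  ring

lemma fanState_charSpeed {γ ρs ε : ℝ} {U : ℝ × ℝ} (hγ : 0 < γ) (hε : 0 < ε)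
    (hU : U.1 ∈ Set.Ioo 0 ρs) :
    fanState γ ρs ε (excessVolume ρs U.1) (charSpeed γ ρs ε (-1) U) = U := by
  have h := hU.1.ne'
  ext
  · simp only [fanState, excessVolume_add, one_div_one_div]
  · simp only [fanState, excessVolume_add, one_div_one_div, charSpeed_eq hγ hε _ hU]
    field_simp
    ring

section Inverse

variable {γ ρs k c : ℝ}

lemma affine_fanSpeed_strictMonoOn (hγ : 0 < γ) (hρs : 0 < ρs) (hk : 0 < k) (c : ℝ) :
    StrictMonoOn (fun w => c + k * fanSpeed γ ρs w) (Set.Ioi 0) := fun _ hx _ hy hxy => by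
  have := mul_lt_mul_of_pos_left (fanSpeed_strictMonoOn hγ hρs hx hy hxy) hk
  simpa using this

/-- The inverse on the half-line exists by strict monotonicity; its derivative is read off from the
local inverse of the inverse function theorem, with which it agrees nearby. -/
lemma exists_affine_fanSpeed_inverse (hγ : 0 < γ) (hρs : 0 < ρs) (hk : 0 < k) (c : ℝ) :
    ∃ y : ℝ → ℝ, ∀ w > 0, y (c + k * fanSpeed γ ρs w) = w ∧
      HasDerivAt y
        (k * ((w + 1 / ρs) * (√γ * ((γ + 1) / 2 * w ^ (-(γ + 1) / 2 - 1)))))⁻¹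
        (c + k * fanSpeed γ ρs w) := by
  set h : ℝ → ℝ := fun w => c + k * fanSpeed γ ρs w with hh
  have hinj : Set.InjOn h (Set.Ioi 0) := (affine_fanSpeed_strictMonoOn hγ hρs hk c).injOn
  have hinv : ∀ w > 0, Function.invFunOn h (Set.Ioi 0) (h w) = w := fun w hw =>
    hinj.leftInvOn_invFunOn hw
  refine ⟨Function.invFunOn h (Set.Ioi 0), fun w hw => ⟨hinv w hw, ?_⟩⟩
  have hder : ∀ x > 0, HasDerivAt h
      (k * ((x + 1 / ρs) * (√γ * ((γ + 1) / 2 * x ^ (-(γ + 1) / 2 - 1))))) x := fun x hx =>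
    ((hasDerivAt_fanSpeed hx).const_mul k).const_add c
  have hcont : ContinuousAt (fun x : ℝ => k * ((x + 1 / ρs) *
      (√γ * ((γ + 1) / 2 * x ^ (-(γ + 1) / 2 - 1))))) w := by
    have := Real.continuousAt_rpow_const w (-(γ + 1) / 2 - 1) (Or.inl (ne_of_gt hw))
    fun_prop
  have hstrict := hasStrictDerivAt_of_hasDerivAt_of_continuousAt
    ((eventually_gt_nhds hw).mono hder) hcont
  have hne := (mul_pos hk (fanSpeed_deriv_pos hγ hρs hw)).ne'
  have hloc := hstrict.to_localInverse hne
  refine hloc.hasDerivAt.congr_of_eventuallyEq ?_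
  have h1 := (hstrict.hasStrictFDerivAt_equiv hne).eventually_right_inverse
  -- Injectivity is known only for positive arguments, so the local inverse must stay positive
  -- before it can be identified with the global one.
  have h2 : ∀ᶠ ξ in 𝓝 (h w), 0 < hstrict.localInverse _ _ _ hne ξ := by
    refine hloc.hasDerivAt.continuousAt.eventually (lt_mem_nhds ?_)
    have : hstrict.localInverse _ _ _ hne (h w) = w :=
      (hstrict.hasStrictFDerivAt_equiv hne).localInverse_apply_image
    rw [this]; exact hw
  filter_upwards [h1, h2] with ξ h3 h4
  have h5 := hinv _ h4
  change h (hstrict.localInverse _ _ _ hne ξ) = ξ at h3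
  rwa [h3] at h5

end Inverse

/-- A rarefaction fan satisfies the equations wherever the excess volume solves the equation for the
characteristic speed. -/
lemma hasDerivAt_fanState {γ ρs ε c w : ℝ} {y : ℝ → ℝ} (hγ : 0 < γ) (hρs : 0 < ρs) (hε : 0 < ε)
    (hw : 0 < w) (hy : y (c + √ε * fanSpeed γ ρs w) = w ∧ HasDerivAt y
      (√ε * ((w + 1 / ρs) * (√γ * ((γ + 1) / 2 * w ^ (-(γ + 1) / 2 - 1)))))⁻¹
      (c + √ε * fanSpeed γ ρs w)) :
    ∃ r : ℝ, HasDerivAt (fun ξ => fanState γ ρs ε (y ξ) ξ)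
      (r • ((1 : ℝ), c + √ε * fanSpeed γ ρs w)) (c + √ε * fanSpeed γ ρs w) := by
  obtain ⟨hyw, hyd⟩ := hy
  set ξ := c + √ε * fanSpeed γ ρs w
  set D := (w + 1 / ρs) * (√γ * ((γ + 1) / 2 * w ^ (-(γ + 1) / 2 - 1))) with hD
  have hD0 : 0 < D := fanSpeed_deriv_pos hγ hρs hw
  have hsε := Real.sqrt_pos.2 hε
  have hv : 0 < w + 1 / ρs := by positivity
  have hρ : HasDerivAt (fun ξ => 1 / (y ξ + 1 / ρs))
      (-(√ε * D)⁻¹ / (w + 1 / ρs) ^ 2) ξ := by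
    have := (hyd.add_const (1 / ρs)).inv (by rw [hyw]; exact hv.ne')
    rw [hyw] at this
    refine this.congr_of_eventuallyEq (Eventually.of_forall fun x => by simp)
  have hg : HasDerivAt (fun ξ => lagSpeed γ (y ξ))
      ((√γ * ((-(γ + 1) / 2) * w ^ (-(γ + 1) / 2 - 1))) * (√ε * D)⁻¹) ξ := by
    have := hasDerivAt_lagSpeed (γ := γ) (w := y ξ) (by rw [hyw]; exact hw)
    rw [hyw] at this
    exact HasDerivAt.comp (h₂ := lagSpeed γ) ξ (by rw [hyw]; exact this) hyd
  refine ⟨-(√ε * D)⁻¹ / (w + 1 / ρs) ^ 2,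
    (hρ.prodMk ((hρ.mul (hasDerivAt_id ξ)).add (hg.const_mul √ε))).congr_deriv ?_⟩
  -- In `q' = ρ' ξ + ρ + √ε (g(w))'` the last two terms cancel, which leaves the direction `(1, ξ)`.
  have hcancel : 1 / (w + 1 / ρs) + √ε * ((√γ * ((-(γ + 1) / 2) * w ^ (-(γ + 1) / 2 - 1))) *
      (√ε * D)⁻¹) = 0 := by
    have : √γ * ((-(γ + 1) / 2) * w ^ (-(γ + 1) / 2 - 1)) = -(D / (w + 1 / ρs)) := by
      rw [hD]; field_simp
    rw [this]
    field_simp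
    ring
  simp only [id, hyw, Prod.smul_mk, smul_eq_mul, mul_one]
  congr 1
  linarith

lemma exists_isRarefaction {γ ρs ε w : ℝ} {L M : ℝ × ℝ} (hγ : 0 < γ) (hε : 0 < ε)
    (hL : L.1 ∈ Set.Ioo 0 ρs) (hM : M.1 ∈ Set.Ioo 0 ρs) (hMw : excessVolume ρs M.1 = w)
    (hw : excessVolume ρs L.1 ≤ w)
    (hu : M.2 / M.1 = L.2 / L.1 + waveJump γ ε (excessVolume ρs L.1) w) :
    ∃ W, IsRarefaction γ ρs ε (-1) (charSpeed γ ρs ε (-1) L) (charSpeed γ ρs ε (-1) M) L M W ∧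
      charSpeed γ ρs ε (-1) M < M.2 / M.1 := by
  have hρs := hL.1.trans hL.2
  have hL0 := excessVolume_pos hL
  have hw0 := hL0.trans_le hw
  have hsε := Real.sqrt_pos.2 hε
  rw [waveJump_of_le hw] at hu
  -- `c` is the Riemann invariant of `L`: on the curve through `L`, the state of excess volume `w`
  -- has characteristic speed `c + √ε * fanSpeed γ ρs w`.
  set c := L.2 / L.1 - √ε * lagPrimitive γ (excessVolume ρs L.1) with hc
  obtain ⟨y, hy⟩ := exists_affine_fanSpeed_inverse hγ hρs hsε c
  have hmono := affine_fanSpeed_strictMonoOn hγ hρs hsε c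
  have ha : charSpeed γ ρs ε (-1) L = c + √ε * fanSpeed γ ρs (excessVolume ρs L.1) := by
    rw [charSpeed_eq hγ hε _ hL, hc, fanSpeed, excessVolume_add]; ring
  have hb : charSpeed γ ρs ε (-1) M = c + √ε * fanSpeed γ ρs w := by
    rw [charSpeed_eq hγ hε _ hM, hc, fanSpeed, ← hMw, excessVolume_add, hu, hMw]; ring
  have hsurj : ∀ ξ ∈ Set.Icc (charSpeed γ ρs ε (-1) L) (charSpeed γ ρs ε (-1) M),
      ∃ x > 0, c + √ε * fanSpeed γ ρs x = ξ := by
    intro ξ hξ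
    rw [ha, hb] at hξ
    obtain ⟨x, hx, rfl⟩ := intermediate_value_Icc
      (f := fun w => c + √ε * fanSpeed γ ρs w) hw
      (fun x hx => (continuousAt_const.add (continuousAt_const.mul (hasDerivAt_fanSpeed
        (hL0.trans_le hx.1)).continuousAt)).continuousWithinAt) hξ
    exact ⟨x, hL0.trans_le hx.1, rfl⟩
  refine ⟨fun ξ => fanState γ ρs ε (y ξ) ξ, ⟨?_, ?_, ?_, ?_, ?_, ?_, ?_⟩, ?_⟩
  · rw [ha, hb]; exact hmono.monotoneOn hL0 hw0 hw
  · intro ξ hξ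
    obtain ⟨x, hx, rfl⟩ := hsurj ξ hξ
    obtain ⟨r, hr⟩ := hasDerivAt_fanState hγ hρs hε hx (hy x hx)
    exact hr.continuousAt.continuousWithinAt
  · rw [show y (charSpeed γ ρs ε (-1) L) = excessVolume ρs L.1 by rw [ha, (hy _ hL0).1],
      fanState_charSpeed hγ hε hL]
  · rw [show y (charSpeed γ ρs ε (-1) M) = excessVolume ρs M.1 by rw [hb, (hy _ hw0).1, hMw],
      fanState_charSpeed hγ hε hM]
  · intro ξ hξ
    obtain ⟨x, hx, rfl⟩ := hsurj ξ ⟨hξ.1.le, hξ.2.le⟩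
    simp only [fanState, (hy x hx).1]
    exact one_div_add_mem_Ioo hρs hx
  · intro ξ hξ
    obtain ⟨x, hx, rfl⟩ := hsurj ξ ⟨hξ.1.le, hξ.2.le⟩
    exact charSpeed_fanState hγ hρs hε (by rw [(hy x hx).1]; exact hx) _
  · intro ξ hξ
    obtain ⟨x, hx, rfl⟩ := hsurj ξ ⟨hξ.1.le, hξ.2.le⟩
    exact hasDerivAt_fanState hγ hρs hε hx (hy x hx)
  · rw [charSpeed_eq hγ hε _ hM]
    have := div_pos (mul_pos hsε (lagSpeed_pos hγ (excessVolume_pos hM))) hM.1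
    linarith

/-! ### Rarefactions that reach the vacuum. -/

/-- If the primitive of the sound speed has a finite limit at the vacuum, then
`w g(w) → 0`. -/
lemma tendsto_mul_lagSpeed {γ G : ℝ} (hγ : 0 < γ) (hG : Tendsto (lagPrimitive γ) atTop (𝓝 G)) :
    Tendsto (fun w => w * lagSpeed γ w) atTop (𝓝 0) := by
  -- As `g` decreases, its integral over `[w/2, w]` is at least `(w/2) g(w)`, while it tends to `G -
  -- G = 0`.
  have h2 : Tendsto (fun w => lagPrimitive γ (w / 2)) atTop (𝓝 G) :=
    hG.comp (tendsto_id.atTop_div_const two_pos)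
  have h3 : Tendsto (fun w => 2 * (lagPrimitive γ w - lagPrimitive γ (w / 2))) atTop (𝓝 0) := by
    simpa using (hG.sub h2).const_mul 2
  refine squeeze_zero' ?_ ?_ h3
  · filter_upwards [eventually_gt_atTop 0] with w hw using (mul_pos hw (lagSpeed_pos hγ hw)).le
  · filter_upwards [eventually_gt_atTop 0] with w hw
    have hpos : ∀ x ∈ Set.Icc (w / 2) w, 0 < x := fun x hx => (half_pos hw).trans_le hx.1
    obtain ⟨θ, hθ, h⟩ := exists_hasDerivAt_eq_slope (lagPrimitive γ) (lagSpeed γ)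
      (half_lt_self hw)
      (fun x hx => (continuousAt_lagPrimitive (hpos x hx)).continuousWithinAt)
      (fun x hx => hasDerivAt_lagPrimitive (hpos x ⟨hx.1.le, hx.2.le⟩))
    have hlt := lagSpeed_strictAntiOn hγ (hpos θ ⟨hθ.1.le, hθ.2.le⟩) hw hθ.2
    rw [h, sub_half, lt_div_iff₀ (half_pos hw)] at hlt
    linarith

lemma tendsto_lagSpeed_atTop {γ : ℝ} (hγ : 0 < γ) : Tendsto (lagSpeed γ) atTop (𝓝 0) := by
  have := (tendsto_rpow_neg_atTop (y := (γ + 1) / 2) (by linarith)).const_mul √γ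
  rw [mul_zero] at this
  refine this.congr fun w => ?_
  rw [lagSpeed, neg_div]

/-- When the primitive tends to `G`, so does the fan speed, because `g(w)` and `w g(w)` vanish at
infinity. The excess volume therefore runs through all large values before the finite speed `b`,
where density and momentum tend to zero. -/
lemma exists_isRarefaction_vacuum {γ ρs ε G : ℝ} {L : ℝ × ℝ} (hγ : 0 < γ) (hε : 0 < ε)
    (hL : L.1 ∈ Set.Ioo 0 ρs) (hG : Tendsto (lagPrimitive γ) atTop (𝓝 G)) :
    ∃ W, IsRarefaction γ ρs ε (-1) (charSpeed γ ρs ε (-1) L)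
      (L.2 / L.1 + √ε * (G - lagPrimitive γ (excessVolume ρs L.1))) L (0, 0) W := by
  have hρs := hL.1.trans hL.2
  have hL0 := excessVolume_pos hL
  have hsε := Real.sqrt_pos.2 hε
  set c := L.2 / L.1 - √ε * lagPrimitive γ (excessVolume ρs L.1) with hc
  set b := L.2 / L.1 + √ε * (G - lagPrimitive γ (excessVolume ρs L.1)) with hb
  obtain ⟨y, hy⟩ := exists_affine_fanSpeed_inverse hγ hρs hsε c
  have hmono := affine_fanSpeed_strictMonoOn hγ hρs hsε c
  have ha : charSpeed γ ρs ε (-1) L = c + √ε * fanSpeed γ ρs (excessVolume ρs L.1) := by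
    rw [charSpeed_eq hγ hε _ hL, hc, fanSpeed, excessVolume_add]; ring
  have hlim : Tendsto (fun w => c + √ε * fanSpeed γ ρs w) atTop (𝓝 b) := by
    have h1 : Tendsto (fanSpeed γ ρs) atTop (𝓝 (G - (0 + 1 / ρs * 0))) := by
      refine (hG.sub ((tendsto_mul_lagSpeed hγ hG).add
        ((tendsto_lagSpeed_atTop hγ).const_mul (1 / ρs)))).congr fun w => ?_
      rw [fanSpeed]; ring
    convert (h1.const_mul √ε).const_add c using 2
    rw [hb, hc]; ring
  have hltb : ∀ x > 0, c + √ε * fanSpeed γ ρs x < b := by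
    intro x hx
    have hx1 : (0 : ℝ) < x + 1 := add_pos hx one_pos
    refine (hmono hx hx1 (lt_add_one x)).trans_le (ge_of_tendsto hlim ?_)
    filter_upwards [eventually_ge_atTop (x + 1)] with z hz
    exact hmono.monotoneOn hx1 (hx1.trans_le hz) hz
  have hsurj : ∀ ξ ∈ Set.Ico (charSpeed γ ρs ε (-1) L) b,
      ∃ x > 0, c + √ε * fanSpeed γ ρs x = ξ := by
    intro ξ hξ
    rw [ha] at hξ
    obtain ⟨z, hz, hLz⟩ := ((hlim.eventually (lt_mem_nhds hξ.2)).and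
      (eventually_ge_atTop (excessVolume ρs L.1))).exists
    obtain ⟨x, hx, rfl⟩ := intermediate_value_Icc
      (f := fun w => c + √ε * fanSpeed γ ρs w) hLz
      (fun x hx => (continuousAt_const.add (continuousAt_const.mul (hasDerivAt_fanSpeed
        (hL0.trans_le hx.1)).continuousAt)).continuousWithinAt) ⟨hξ.1, hz.le⟩
    exact ⟨x, hL0.trans_le hx.1, rfl⟩
  have hab : charSpeed γ ρs ε (-1) L < b := ha ▸ hltb _ hL0
  have hytop : Tendsto y (𝓝[Set.Ico (charSpeed γ ρs ε (-1) L) b] b) atTop := by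
    refine tendsto_atTop.2 fun V => ?_
    have hV : 0 < max V 1 := lt_max_of_lt_right one_pos
    have h1 : ∀ᶠ ξ in 𝓝[Set.Ico (charSpeed γ ρs ε (-1) L) b] b,
        c + √ε * fanSpeed γ ρs (max V 1) < ξ := nhdsWithin_le_nhds (lt_mem_nhds (hltb _ hV))
    filter_upwards [h1, self_mem_nhdsWithin] with ξ h2 h3
    obtain ⟨x, hx, rfl⟩ := hsurj ξ h3
    rw [(hy x hx).1]
    exact (le_max_left _ _).trans ((hmono.lt_iff_lt hV hx).1 h2).le
  have hend : Tendsto (fun ξ => fanState γ ρs ε (y ξ) ξ)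
      (𝓝[Set.Ico (charSpeed γ ρs ε (-1) L) b] b) (𝓝 (0, 0)) := by
    have h1 : Tendsto (fun ξ => 1 / (y ξ + 1 / ρs))
        (𝓝[Set.Ico (charSpeed γ ρs ε (-1) L) b] b) (𝓝 0) :=
      tendsto_const_nhds.div_atTop (tendsto_atTop_add_const_right _ _ hytop)
    have h2 := (tendsto_lagSpeed_atTop hγ).comp hytop
    have h3 : Tendsto (fun ξ : ℝ => ξ) (𝓝[Set.Ico (charSpeed γ ρs ε (-1) L) b] b) (𝓝 b) :=
      tendsto_id.mono_left nhdsWithin_le_nhds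
    simpa [fanState] using h1.prodMk_nhds ((h1.mul h3).add (h2.const_mul √ε))
  -- The inverse `y` means nothing from `b` on, since no excess volume has that speed; the vacuum is
  -- put in by hand.
  set W : ℝ → ℝ × ℝ := fun ξ => if ξ < b then fanState γ ρs ε (y ξ) ξ else (0, 0) with hW
  have hWlt : ∀ ξ < b, W ξ = fanState γ ρs ε (y ξ) ξ := fun ξ hξ => if_pos hξ
  have hWev : ∀ ξ < b, W =ᶠ[𝓝 ξ] fun ξ => fanState γ ρs ε (y ξ) ξ := fun ξ hξ => by
    filter_upwards [gt_mem_nhds hξ] with x hx using hWlt x hx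
  have hWb : W b = (0, 0) := if_neg (lt_irrefl b)
  refine ⟨W, ⟨hab.le, ?_, ?_, hWb, ?_, ?_, ?_⟩⟩
  · intro ξ hξ
    rcases hξ.2.eq_or_lt with rfl | hlt
    · rw [← Set.Ico_union_right hab.le, continuousWithinAt_union]
      refine ⟨?_, continuousWithinAt_singleton⟩
      rw [ContinuousWithinAt, hWb]
      refine hend.congr' ?_
      filter_upwards [self_mem_nhdsWithin] with x hx using (hWlt x hx.2).symm
    · obtain ⟨x, hx, rfl⟩ := hsurj ξ ⟨hξ.1, hlt⟩
      obtain ⟨r, hr⟩ := hasDerivAt_fanState hγ hρs hε hx (hy x hx)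
      exact (hr.congr_of_eventuallyEq (hWev _ hlt)).continuousAt.continuousWithinAt
  · rw [hWlt _ hab, show y (charSpeed γ ρs ε (-1) L) = excessVolume ρs L.1 by
      rw [ha, (hy _ hL0).1], fanState_charSpeed hγ hε hL]
  · intro ξ hξ
    rw [hWlt _ hξ.2]
    obtain ⟨x, hx, rfl⟩ := hsurj ξ ⟨hξ.1.le, hξ.2⟩
    simp only [fanState, (hy x hx).1]
    exact one_div_add_mem_Ioo hρs hx
  · intro ξ hξ
    rw [hWlt _ hξ.2]
    obtain ⟨x, hx, rfl⟩ := hsurj ξ ⟨hξ.1.le, hξ.2⟩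
    exact charSpeed_fanState hγ hρs hε (by rw [(hy x hx).1]; exact hx) _
  · intro ξ hξ
    obtain ⟨x, hx, rfl⟩ := hsurj ξ ⟨hξ.1.le, hξ.2⟩
    obtain ⟨r, hr⟩ := hasDerivAt_fanState hγ hρs hε hx (hy x hx)
    exact ⟨r, hr.congr_of_eventuallyEq (hWev _ hξ.2)⟩

/-! ### Existence of a solution at fixed `ε`. -/

lemma exists_isFirstWave {γ ρs ε w : ℝ} {L M : ℝ × ℝ} (hγ : 0 < γ) (hε : 0 < ε)
    (hL : L.1 ∈ Set.Ioo 0 ρs) (hM : M.1 ∈ Set.Ioo 0 ρs) (hMw : excessVolume ρs M.1 = w)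
    (hu : M.2 / M.1 = L.2 / L.1 + waveJump γ ε (excessVolume ρs L.1) w) :
    ∃ a b W, IsFirstWave γ ρs ε a b L M W ∧ b < M.2 / M.1 := by
  rcases lt_or_ge w (excessVolume ρs L.1) with hw | hw
  · obtain ⟨σ, h1, h2⟩ := exists_isShock hγ hε hL hM hMw hw hu
    exact ⟨σ, σ, fun _ => L, Or.inl ⟨rfl, h1⟩, h2⟩
  · obtain ⟨W, h1, h2⟩ := exists_isRarefaction hγ hε hL hM hMw hw hu
    exact ⟨_, _, W, Or.inr ⟨rfl, h1⟩, h2⟩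

lemma IsRarefaction.congr {γ ρs ε s a b : ℝ} {L R : ℝ × ℝ} {W W' : ℝ → ℝ × ℝ}
    (h : IsRarefaction γ ρs ε s a b L R W) (hW : Set.EqOn W' W (Set.Icc a b)) :
    IsRarefaction γ ρs ε s a b L R W' where
  le := h.le
  cont := h.cont.congr hW
  left_val := by rw [hW ⟨le_rfl, h.le⟩, h.left_val]
  right_val := by rw [hW ⟨h.le, le_rfl⟩, h.right_val]
  density_mem ξ hξ := by rw [hW ⟨hξ.1.le, hξ.2.le⟩]; exact h.density_mem ξ hξ
  speed ξ hξ := by rw [hW ⟨hξ.1.le, hξ.2.le⟩]; exact h.speed ξ hξ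
  integral_curve ξ hξ := by
    obtain ⟨r, hr⟩ := h.integral_curve ξ hξ
    refine ⟨r, hr.congr_of_eventuallyEq ?_⟩
    filter_upwards [isOpen_Ioo.mem_nhds hξ] with x hx using hW ⟨hx.1.le, hx.2.le⟩

lemma IsFirstWave.le {γ ρs ε a b : ℝ} {L M : ℝ × ℝ} {W : ℝ → ℝ × ℝ}
    (h : IsFirstWave γ ρs ε a b L M W) : a ≤ b := by
  rcases h with h | h
  exacts [h.1.le, h.2.le]

/-- Two waves whose extents are ordered make a solution of the Riemann problem; the second one is given
by its mirror image. -/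
lemma exists_isRiemannSolution_of_waves {γ ρs ε a b a' b' : ℝ} {L M R : ℝ × ℝ}
    {W W' : ℝ → ℝ × ℝ} (hM : M.1 ∈ Set.Ioo 0 ρs ∨ M = (0, 0))
    (h₁ : IsFirstWave γ ρs ε a b L M W)
    (h₂ : IsFirstWave γ ρs ε a' b' (mirror R) (mirror M) W') (hb : b ≤ -b')
    (hr : b = -b' → M = (0, 0)) :
    ∃ F, IsRiemannSolution γ ρs ε L R F := by
  have hab := h₁.le
  have hab' := h₂.le
  set P : ℝ → ℝ × ℝ := fun ξ => if ξ < a then L else if ξ ≤ b then W ξ else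
    if ξ < -b' then M else if ξ ≤ -a' then mirror (W' (-ξ)) else R with hP
  have hP1 : Set.EqOn P W (Set.Icc a b) := fun ξ hξ => by
    simp [hP, not_lt.2 hξ.1, hξ.2]
  -- If the two waves touch, the glued profile takes the value of the first one at the common point,
  -- so the end values have to agree there.
  have hP2 : (∀ _ : b = -b', W b = mirror (W' b')) →
      Set.EqOn P (fun ξ => mirror (W' (-ξ))) (Set.Icc (-b') (-a')) := fun he ξ hξ => by
    have h3 : ¬ ξ < a := by linarith [hξ.1]
    rcases hξ.1.eq_or_lt with rfl | hlt
    · rcases hb.eq_or_lt with h4 | h4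
      · have := he h4
        simp only [hP, if_neg h3]
        rw [← h4, if_pos le_rfl, this, h4, neg_neg]
      · simp [hP, h3, h4, neg_le_neg hab']
    · have h4 : ¬ ξ ≤ b := by linarith
      simp [hP, h3, h4, not_lt.2 hξ.1, hξ.2]
  refine ⟨⟨P, M, a, b, -b', -a'⟩, ⟨hM, hb, ?_, ?_, ?_, ?_, ?_⟩⟩
  · intro ξ hξ
    exact if_pos hξ
  · intro ξ hξ
    have h3 : ¬ ξ < a := by linarith [hξ.1]
    simp [hP, h3, not_le.2 hξ.1, hξ.2]
  · intro ξ hξ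
    change -a' < ξ at hξ
    have h3 : ¬ ξ < a := by linarith
    have h4 : ¬ ξ ≤ b := by linarith
    have h5 : ¬ ξ < -b' := by linarith
    simp [hP, h3, h4, h5, not_le.2 hξ]
  · rcases h₁ with h | h
    · exact Or.inl h
    · exact Or.inr ⟨h.1, h.2.congr hP1⟩
  · rcases h₂ with ⟨h3, h4⟩ | ⟨h3, h4⟩
    · left
      refine ⟨by rw [h3], ?_⟩
      have := h4.mirror
      simp only [mirror_mirror, neg_neg] at this
      rw [h3] at this
      exact this
    · right
      refine ⟨?_, ?_⟩
      · change -a' = _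
        rw [h3]
        simpa using (charSpeed_mirror γ ρs ε (-1) (mirror R)).symm
      have h5 := h4.mirror
      simp only [mirror_mirror, neg_neg] at h5
      refine h5.congr (hP2 fun he => ?_)
      -- Waves touch only at the vacuum. A shock cannot end there, so the first wave is a
      -- rarefaction and its end value is `M`.
      have hMz := hr he
      rw [h4.right_val, mirror_mirror]
      rcases h₁ with ⟨-, h⟩ | ⟨-, h⟩
      · have := h.right_mem.1
        rw [hMz] at this
        exact absurd this (lt_irrefl _)
      · exact h.right_val

/-- For small `w` both waves are shocks, and the blow-up of the pressure at `w = 0` makes the first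
jump alone as negative as desired. This is the lower end for the intermediate value theorem. -/
lemma exists_waveJump_add_le {γ ε : ℝ} (hγ : 0 < γ) (hε : 0 < ε) {w₁ w₂ : ℝ} (h₁ : 0 < w₁)
    (h₂ : 0 < w₂) (D : ℝ) : ∃ w > 0, waveJump γ ε w₁ w + waveJump γ ε w₂ w ≤ D := by
  have hp : Tendsto (fun w : ℝ => w ^ (-γ)) (𝓝[>] 0) atTop :=
    tendsto_rpow_neg_nhdsGT_zero (neg_neg_of_pos hγ)
  -- For `w < w₁ / 2` the factor `w₁ - w` is at least `w₁ / 2`, so a product above `D ^ 2` gives a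
  -- jump below `-|D|`.
  have h3 : Tendsto (fun w : ℝ => ε * (w ^ (-γ) - w₁ ^ (-γ)) * (w₁ / 2)) (𝓝[>] 0) atTop :=
    ((tendsto_atTop_add_const_right _ (-(w₁ ^ (-γ))) hp).const_mul_atTop hε).atTop_mul_const
      (half_pos h₁)
  have hsmall : ∀ᶠ w in 𝓝[>] (0 : ℝ), w < min (w₁ / 2) w₂ :=
    nhdsWithin_le_nhds (gt_mem_nhds (lt_min (half_pos h₁) h₂))
  obtain ⟨w, h4, h5, h6⟩ := ((h3.eventually (eventually_ge_atTop (D ^ 2))).and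
    (hsmall.and self_mem_nhdsWithin)).exists
  have hw : 0 < w := h6
  have h7 := h5.trans_le (min_le_left _ _)
  have h8 := h5.trans_le (min_le_right _ _)
  have hw1 : w ≤ w₁ := by linarith
  refine ⟨w, hw, ?_⟩
  rw [waveJump_of_ge hw1, waveJump_of_ge h8.le]
  have h9 : |D| ≤ √(ε * (w ^ (-γ) - w₁ ^ (-γ)) * (w₁ - w)) := by
    rw [← Real.sqrt_sq_eq_abs]
    refine Real.sqrt_le_sqrt (h4.trans (mul_le_mul_of_nonneg_left (by linarith) ?_))
    have := Real.rpow_le_rpow_of_nonpos hw hw1 (neg_nonpos.2 hγ.le)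
    exact mul_nonneg hε.le (sub_nonneg.2 this)
  have := Real.sqrt_nonneg (ε * (w ^ (-γ) - w₂ ^ (-γ)) * (w₂ - w))
  linarith [neg_abs_le D]

lemma exists_tendsto_lagPrimitive {γ B : ℝ} (hγ : 0 < γ)
    (h : ∀ᶠ w in atTop, lagPrimitive γ w ≤ B) : ∃ G, Tendsto (lagPrimitive γ) atTop (𝓝 G) := by
  -- Truncation at `1` makes the primitive monotone on the whole line without changing its limit.
  have hmono : Monotone fun w => lagPrimitive γ (max w 1) := fun x y hxy =>
    (lagPrimitive_strictMonoOn hγ).monotoneOn (Set.mem_Ioi.2 (lt_max_of_lt_right one_pos))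
      (Set.mem_Ioi.2 (lt_max_of_lt_right one_pos)) (max_le_max_right 1 hxy)
  have hbdd : BddAbove (Set.range fun w => lagPrimitive γ (max w 1)) := by
    refine ⟨B, ?_⟩
    rintro _ ⟨w, rfl⟩
    obtain ⟨z, hz, hwz⟩ := (h.and (eventually_ge_atTop (max w 1))).exists
    exact ((lagPrimitive_strictMonoOn hγ).monotoneOn (Set.mem_Ioi.2 (lt_max_of_lt_right one_pos))
      (lt_of_lt_of_le (lt_max_of_lt_right one_pos) hwz) hwz).trans hz
  refine ⟨_, (tendsto_atTop_ciSup hmono hbdd).congr' ?_⟩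
  filter_upwards [eventually_ge_atTop 1] with w hw
  rw [max_eq_left hw]

/-- The second wave, reflected, has the same jump function, so an intermediate state is a solution
`w` of one scalar equation. If the required jump `D` exceeds all attainable ones, the rarefaction
branches bound the primitive of `g`, and the vacuum is inserted. -/
theorem exists_isRiemannSolution {γ ρs ε : ℝ} {L R : ℝ × ℝ} (hγ : 0 < γ) (hε : 0 < ε)
    (hL : L.1 ∈ Set.Ioo 0 ρs) (hR : R.1 ∈ Set.Ioo 0 ρs) :
    ∃ F, IsRiemannSolution γ ρs ε L R F := by
  have hρs := hL.1.trans hL.2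
  have hwL := excessVolume_pos hL
  have hwR := excessVolume_pos hR
  have hsε := Real.sqrt_pos.2 hε
  set wL := excessVolume ρs L.1 with hwLdef
  set wR := excessVolume ρs R.1 with hwRdef
  set D := R.2 / R.1 - L.2 / L.1 with hD
  obtain ⟨w₀, hw₀, hle⟩ := exists_waveJump_add_le hγ hε hwL hwR D
  by_cases hge : ∃ w > 0, D ≤ waveJump γ ε wL w + waveJump γ ε wR w
  · obtain ⟨w₁, hw₁, hge⟩ := hge
    obtain ⟨w, hw, hwD⟩ := isPreconnected_Ioi.intermediate_value (s := Set.Ioi (0 : ℝ)) hw₀ hw₁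
      (f := fun w => waveJump γ ε wL w + waveJump γ ε wR w)
      ((continuousOn_waveJump γ ε hwL).add (continuousOn_waveJump γ ε hwR)) ⟨hle, hge⟩
    have hρ := one_div_add_mem_Ioo hρs hw
    set M : ℝ × ℝ := (1 / (w + 1 / ρs), 1 / (w + 1 / ρs) * (L.2 / L.1 + waveJump γ ε wL w))
      with hMdef
    have hM1 : M.1 = 1 / (w + 1 / ρs) := rfl
    have hM : M.1 ∈ Set.Ioo 0 ρs := hρ
    have hMw : excessVolume ρs M.1 = w := excessVolume_one_div ρs w
    have hMu : M.2 / M.1 = L.2 / L.1 + waveJump γ ε wL w := mul_div_cancel_left₀ _ hρ.1.ne'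
    obtain ⟨a, b, W, h1, hb⟩ := exists_isFirstWave hγ hε hL hM hMw hMu
    obtain ⟨a', b', W', h2, hb'⟩ := exists_isFirstWave (L := mirror R) (M := mirror M) hγ hε hR hM
      hMw (by
        simp only [mirror_fst, mirror_snd, neg_div, hMu]
        change waveJump γ ε wL w + waveJump γ ε wR w = D at hwD
        linarith)
    simp only [mirror_fst, mirror_snd, neg_div] at hb'
    exact exists_isRiemannSolution_of_waves (Or.inl hM) h1 h2 (by linarith)
      (fun h => absurd h (by linarith))
  · push Not at hge
    have hbound : ∀ᶠ w in atTop, √ε * (2 * lagPrimitive γ w) ≤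
        D + √ε * (lagPrimitive γ wL + lagPrimitive γ wR) := by
      filter_upwards [eventually_ge_atTop wL, eventually_ge_atTop wR] with w h1 h2
      have := hge w (hwL.trans_le h1)
      rw [waveJump_of_le h1, waveJump_of_le h2] at this
      linarith
    obtain ⟨G, hG⟩ := exists_tendsto_lagPrimitive (γ := γ)
      (B := (D + √ε * (lagPrimitive γ wL + lagPrimitive γ wR)) / √ε / 2) hγ (by
        filter_upwards [hbound] with w hw
        rw [le_div_iff₀ two_pos, le_div_iff₀ hsε]
        linarith)
    -- In the limit the bound says exactly that the left fan reaches the vacuum no later than the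
    -- right fan leaves it.
    have hGle := le_of_tendsto ((hG.const_mul 2).const_mul √ε) hbound
    obtain ⟨W, h1⟩ := exists_isRarefaction_vacuum hγ hε hL hG
    obtain ⟨W', h2⟩ := exists_isRarefaction_vacuum (L := mirror R) hγ hε hR hG
    have h0 : mirror (0, 0) = (0, 0) := by simp [mirror]
    refine exists_isRiemannSolution_of_waves (M := (0, 0)) (Or.inr rfl) (Or.inr ⟨rfl, h1⟩)
      (Or.inr ⟨rfl, by rw [h0]; exact h2⟩) ?_ (fun _ => rfl)
    simp only [mirror_fst, mirror_snd, neg_div, ← hwLdef, ← hwRdef]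
    linarith

/-! ### Estimates for an arbitrary solution at fixed `ε`. -/

lemma isFirstWave_mirror {γ ρs ε : ℝ} {L R : ℝ × ℝ} {F : WaveFan}
    (h : IsRiemannSolution γ ρs ε L R F) :
    IsFirstWave γ ρs ε (-F.b₂) (-F.a₂) (mirror R) (mirror F.mid)
      (fun ξ => mirror (F.profile (-ξ))) :=
  h.mirror.first_wave

/-- Shocks lower the velocity, and rarefactions raise it only through the primitive. Used from both
sides, this shows that widely separated end velocities force a dilute intermediate state. -/
lemma IsFirstWave.velocity_le {γ ρs ε a b V : ℝ} {L M : ℝ × ℝ} {W : ℝ → ℝ × ℝ}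
    (hγ : 0 < γ) (hε : 0 < ε) (h : IsFirstWave γ ρs ε a b L M W) (hL : L.1 ∈ Set.Ioo 0 ρs)
    (hM : M.1 ∈ Set.Ioo 0 ρs) (hLV : excessVolume ρs L.1 ≤ V) (hMV : excessVolume ρs M.1 ≤ V) :
    M.2 / M.1 ≤ L.2 / L.1 +
      √ε * (lagPrimitive γ V - lagPrimitive γ (excessVolume ρs L.1)) := by
  have hV : 0 < V := (excessVolume_pos hL).trans_le hLV
  have hmono := (lagPrimitive_strictMonoOn hγ).monotoneOn
  rcases h with ⟨-, h⟩ | ⟨ha, h⟩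
  · obtain ⟨m, hm, -, h2, -, -, h3⟩ := h.exists_flux hγ hε
    have h4 := mul_pos hm (sub_pos.2 h3)
    have h5 := mul_nonneg (Real.sqrt_nonneg ε) (sub_nonneg.2 (hmono (excessVolume_pos hL) hV hLV))
    linarith
  · have h1 := (h.riemann_invariant hγ hε hL ha ⟨h.le, le_rfl⟩ (by rw [h.right_val]; exact hM)).1
    rw [h.right_val] at h1
    rw [h1]
    gcongr
    exact hmono (excessVolume_pos hM) hV hMV

lemma norm_fullState (γ ρs ε : ℝ) (U : ℝ × ℝ) :
    ‖fullState γ ρs ε U‖ = max |U.1| (max |U.2| |ε * pressure γ ρs U.1|) := rfl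

/-- The bound of a state of excess volume at least `V` whose characteristic speed is at most `B`. -/
noncomputable def rareBound (γ ε V B : ℝ) : ℝ :=
  1 / V + (B / V + √ε * lagSpeed γ V) + ε * V ^ (-γ)

lemma norm_fullState_le {γ ρs ε V B ξ : ℝ} {U : ℝ × ℝ} (hγ : 0 < γ) (hε : 0 < ε) (hV : 0 < V)
    (hU : U.1 ∈ Set.Ioo 0 ρs) (hVU : V < excessVolume ρs U.1) (hB : |ξ| ≤ B)
    (hq : U.2 = U.1 * ξ + √ε * lagSpeed γ (excessVolume ρs U.1)) :
    ‖fullState γ ρs ε U‖ ≤ rareBound γ ε V B := by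
  have hU1 := hU.1
  have hw := excessVolume_pos hU
  have hB0 : 0 ≤ B := (abs_nonneg ξ).trans hB
  have hgV := lagSpeed_pos hγ hV
  have hg := lagSpeed_pos hγ hw
  have h1 : U.1 ≤ 1 / V := by
    have h : 0 < 1 / ρs := one_div_pos.2 (hU.1.trans hU.2)
    rw [le_div_iff₀ hV, mul_comm, ← le_div_iff₀ hU1, ← excessVolume_add ρs]
    linarith
  have h2 : |U.2| ≤ B / V + √ε * lagSpeed γ V := by
    rw [hq]
    refine (abs_add_le _ _).trans (add_le_add ?_ ?_)
    · rw [abs_mul, abs_of_pos hU1, div_eq_mul_one_div, mul_comm B]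
      exact mul_le_mul h1 hB (abs_nonneg _) (by positivity)
    · rw [abs_of_nonneg (by positivity)]
      exact mul_le_mul_of_nonneg_left ((lagSpeed_strictAntiOn hγ).antitoneOn hV hw hVU.le)
        (Real.sqrt_nonneg _)
  have h3 : |ε * pressure γ ρs U.1| ≤ ε * V ^ (-γ) := by
    rw [pressure_eq hU, abs_of_nonneg (by positivity)]
    exact mul_le_mul_of_nonneg_left
      (Real.rpow_le_rpow_of_nonpos hV hVU.le (neg_nonpos.2 hγ.le)) hε.le
  have e1 : 0 ≤ 1 / V := by positivity
  have e2 : 0 ≤ B / V + √ε * lagSpeed γ V := by positivity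
  have e3 : 0 ≤ ε * V ^ (-γ) := by positivity
  rw [norm_fullState, rareBound, abs_of_pos hU1]
  exact max_le (by linarith) (max_le (by linarith) (by linarith))

@[simp] lemma fullState_vacuum (γ ρs ε : ℝ) : fullState γ ρs ε (0, 0) = 0 := by
  simp [fullState, pressure]

lemma rareBound_nonneg {γ ε V B : ℝ} (hγ : 0 < γ) (hε : 0 < ε) (hV : 0 < V) (hB : 0 ≤ B) :
    0 ≤ rareBound γ ε V B := by
  have := lagSpeed_pos hγ hV
  unfold rareBound; positivity

/-- A wave of the first family into a very dilute state is a rarefaction, and it is dilute away from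
its left end. -/
lemma IsFirstWave.dilute {γ ρs ε a b V : ℝ} {L M : ℝ × ℝ} {W : ℝ → ℝ × ℝ}
    (hγ : 0 < γ) (hε : 0 < ε) (h : IsFirstWave γ ρs ε a b L M W) (hL : L.1 ∈ Set.Ioo 0 ρs)
    (hLV : excessVolume ρs L.1 ≤ V)
    (hM : M = (0, 0) ∨ M.1 ∈ Set.Ioo 0 ρs ∧ V < excessVolume ρs M.1) :
    a = charSpeed γ ρs ε (-1) L ∧ (∀ B, |b| ≤ B → ‖fullState γ ρs ε M‖ ≤ rareBound γ ε V B) ∧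
    ∀ ξ ∈ Set.Icc a b,
      a + √ε * (fanSpeed γ ρs V - fanSpeed γ ρs (excessVolume ρs L.1)) < ξ → ∀ B, |ξ| ≤ B →
      ‖fullState γ ρs ε (W ξ)‖ ≤ rareBound γ ε V B := by
  have hV : 0 < V := (excessVolume_pos hL).trans_le hLV
  rcases h with ⟨-, h⟩ | ⟨ha, h⟩
  -- A shock of the first family lowers the excess volume and has no vacuum side, whereas `M` is the
  -- vacuum or more dilute than `L`.
  · exfalso
    obtain ⟨m, -, -, -, -, -, h3⟩ := h.exists_flux hγ hε
    rcases hM with rfl | ⟨-, hM⟩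
    · exact lt_irrefl _ h.right_mem.1
    · linarith
  · refine ⟨ha, fun B hB => ?_, fun ξ hξ hlt B hB => ?_⟩
    · rcases hM with rfl | ⟨hM, hVM⟩
      · simpa using rareBound_nonneg hγ hε hV ((abs_nonneg _).trans hB)
      · have h1 := (h.fanSpeed_sub hγ hε hL ha ⟨h.le, le_rfl⟩ (by rw [h.right_val]; exact hM)).2.1
        rw [h.right_val] at h1
        exact norm_fullState_le hγ hε hV hM hVM hB h1
    · have hor : W ξ = (0, 0) ∨ (W ξ).1 ∈ Set.Ioo 0 ρs := by
        rcases hξ.1.eq_or_lt with rfl | h1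
        · right; rw [h.left_val]; exact hL
        rcases hξ.2.eq_or_lt with rfl | h2
        · rw [h.right_val]; exact hM.imp_right And.left
        · exact Or.inr (h.density_mem ξ ⟨h1, h2⟩)
      rcases hor with h0 | hW
      · rw [h0]
        simpa using rareBound_nonneg hγ hε hV ((abs_nonneg _).trans hB)
      · obtain ⟨h1, h2, -⟩ := h.fanSpeed_sub hγ hε hL ha hξ hW
        refine norm_fullState_le hγ hε hV hW ?_ hB h2
        have h3 : √ε * (fanSpeed γ ρs V - fanSpeed γ ρs (excessVolume ρs L.1)) <
            √ε * (fanSpeed γ ρs (excessVolume ρs (W ξ).1) -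
              fanSpeed γ ρs (excessVolume ρs L.1)) := by linarith
        have h4 := lt_of_mul_lt_mul_left h3 (Real.sqrt_nonneg _)
        exact ((fanSpeed_strictMonoOn hγ (hL.1.trans hL.2)).lt_iff_lt hV
          (excessVolume_pos hW)).1 (by linarith)

lemma norm_fullState_mirror (γ ρs ε : ℝ) (U : ℝ × ℝ) :
    ‖fullState γ ρs ε (mirror U)‖ = ‖fullState γ ρs ε U‖ := by
  simp [norm_fullState]

/-- If the velocities of the end states are far apart in comparison with `√ε`, then the middle part of
the fan is dilute. -/
lemma IsRiemannSolution.dilute {γ ρs ε V : ℝ} {L R : ℝ × ℝ} {F : WaveFan} (hγ : 0 < γ)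
    (hε : 0 < ε) (h : IsRiemannSolution γ ρs ε L R F) (hL : L.1 ∈ Set.Ioo 0 ρs)
    (hR : R.1 ∈ Set.Ioo 0 ρs) (hLV : excessVolume ρs L.1 ≤ V) (hRV : excessVolume ρs R.1 ≤ V)
    (hlt : √ε * (2 * lagPrimitive γ V - lagPrimitive γ (excessVolume ρs L.1) -
      lagPrimitive γ (excessVolume ρs R.1)) < R.2 / R.1 - L.2 / L.1) :
    F.a₁ = charSpeed γ ρs ε (-1) L ∧ F.b₂ = charSpeed γ ρs ε 1 R ∧
    ‖fullState γ ρs ε F.mid‖ ≤ rareBound γ ε V (|F.a₁| + |F.b₂|) ∧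
    ∀ ξ ∈ Set.Icc F.a₁ F.b₂,
      F.a₁ + √ε * (fanSpeed γ ρs V - fanSpeed γ ρs (excessVolume ρs L.1)) < ξ →
      ξ < F.b₂ - √ε * (fanSpeed γ ρs V - fanSpeed γ ρs (excessVolume ρs R.1)) →
      ‖fullState γ ρs ε (F.profile ξ)‖ ≤ rareBound γ ε V (|F.a₁| + |F.b₂|) := by
  have h₁ : IsFirstWave γ ρs ε F.a₁ F.b₁ L F.mid F.profile := h.first_wave
  have h₂ := isFirstWave_mirror h
  have hmid : F.mid = (0, 0) ∨ F.mid.1 ∈ Set.Ioo 0 ρs ∧ V < excessVolume ρs F.mid.1 := by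
    rcases h.mid_mem with hm | hm
    · refine Or.inr ⟨hm, ?_⟩
      -- Otherwise the bounds across the two waves add up to a velocity difference too small for
      -- `hlt`.
      by_contra hle
      push Not at hle
      have e1 := h₁.velocity_le hγ hε hL hm hLV hle
      have e2 := h₂.velocity_le hγ hε hR hm hRV hle
      simp only [mirror_fst, mirror_snd, neg_div] at e2
      linarith
    · exact Or.inl hm
  obtain ⟨ha, hmb, hp⟩ := h₁.dilute hγ hε hL hLV hmid
  obtain ⟨ha', -, hp'⟩ := h₂.dilute hγ hε (V := V) hR hRV (by
    rcases hmid with hm | hm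
    · left; simp [hm, _root_.mirror]
    · exact Or.inr hm)
  have hle := h₁.le
  have hle' := neg_le_neg_iff.1 h₂.le
  have hord := h.order
  have habs : ∀ ξ ∈ Set.Icc F.a₁ F.b₂, |ξ| ≤ |F.a₁| + |F.b₂| := by
    intro ξ hξ
    rw [abs_le]
    constructor
    · linarith [hξ.1, neg_abs_le F.a₁, abs_nonneg F.b₂]
    · linarith [hξ.2, le_abs_self F.b₂, abs_nonneg F.a₁]
  have hmb' := hmb _ (habs F.b₁ ⟨hle, by linarith⟩)
  refine ⟨ha, ?_, hmb', fun ξ hξ h3 h4 => ?_⟩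
  · have := charSpeed_mirror γ ρs ε 1 R
    linarith
  · rcases le_or_gt ξ F.b₁ with h5 | h5
    · exact hp ξ ⟨hξ.1, h5⟩ h3 _ (habs ξ hξ)
    rcases lt_or_ge ξ F.a₂ with h6 | h6
    · rw [h.mid_const ξ ⟨h5, h6⟩]
      exact hmb'
    · have := hp' (-ξ) ⟨neg_le_neg hξ.2, neg_le_neg h6⟩ (by simp only [mirror_fst]; linarith)
        (|F.a₁| + |F.b₂|) (by rw [abs_neg]; exact habs ξ hξ)
      rwa [norm_fullState_mirror, neg_neg] at this

/-- If the left state catches up with the right one fast enough, the first wave is a shock. -/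
lemma IsRiemannSolution.first_isShock {γ ρs ε : ℝ} {L R : ℝ × ℝ} {F : WaveFan} (hγ : 0 < γ)
    (hε : 0 < ε) (h : IsRiemannSolution γ ρs ε L R F) (hL : L.1 ∈ Set.Ioo 0 ρs)
    (hlt : R.2 / R.1 < L.2 / L.1)
    (hsq : ε * excessVolume ρs L.1 ^ (-γ) * excessVolume ρs R.1 < (L.2 / L.1 - R.2 / R.1) ^ 2)
    (hch : charSpeed γ ρs ε 1 R < charSpeed γ ρs ε (-1) L) :
    F.a₁ = F.b₁ ∧ IsShock γ ρs ε (-1) F.a₁ L F.mid := by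
  rcases h.first_wave with h₁ | ⟨ha, h₁⟩
  · exact h₁
  -- After a first rarefaction, the middle state is faster and more dilute than `L`. A second shock
  -- would have to absorb the whole velocity drop, with squared strength at most `ε w_L ^ (-γ) *
  -- w_R`, against `hsq`; a second rarefaction would put the outer speeds in the order excluded by
  -- `hch`.
  exfalso
  have hord := h.order
  have hle := h₁.le
  rcases h.second_wave with ⟨-, h₂⟩ | ⟨hb, h₂⟩
  · have hM := h₂.left_mem
    have hwM := excessVolume_pos hM
    have hwL := excessVolume_pos hL
    have hb' : F.b₁ ∈ Set.Icc F.a₁ F.b₁ := ⟨hle, le_rfl⟩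
    have hW : (F.profile F.b₁).1 ∈ Set.Ioo 0 ρs := by rw [h₁.right_val]; exact hM
    have e1 := (h₁.riemann_invariant hγ hε hL ha hb' hW).1
    have e2 := (h₁.fanSpeed_sub hγ hε hL ha hb' hW).2.2
    rw [h₁.right_val] at e1 e2
    have e3 := mul_nonneg (Real.sqrt_nonneg ε) (sub_nonneg.2
      ((lagPrimitive_strictMonoOn hγ).monotoneOn hwL hwM e2))
    obtain ⟨m, hm, f1, f2, -, -, f3⟩ := h₂.mirror.exists_flux hγ hε
    simp only [mirror_fst, mirror_snd, neg_div] at f1 f2 f3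
    set X := excessVolume ρs R.1 - excessVolume ρs F.mid.1 with hX
    have hX0 : 0 < X := sub_pos.2 f3
    have hp := Real.rpow_le_rpow_of_nonpos hwL e2 (neg_nonpos.2 hγ.le)
    have hpR : 0 ≤ ε * excessVolume ρs R.1 ^ (-γ) :=
      mul_nonneg hε.le (Real.rpow_nonneg (hwM.trans f3).le _)
    have h3 : (L.2 / L.1 - R.2 / R.1) ^ 2 ≤ (m * X) ^ 2 :=
      pow_le_pow_left₀ (by linarith) (by linarith) 2
    have h4 : (m * X) ^ 2 = m ^ 2 * X * X := by ring
    have h5 : m ^ 2 * X * X ≤ ε * excessVolume ρs L.1 ^ (-γ) * excessVolume ρs R.1 := by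
      refine mul_le_mul ?_ (by linarith) hX0.le
        (mul_nonneg hε.le (Real.rpow_nonneg hwL.le _))
      rw [f1]
      have := mul_le_mul_of_nonneg_left hp hε.le
      linarith
    linarith
  · have := h₂.le
    linarith

/-- The strength of a shock of the first family in terms of the densities. -/
lemma IsShock.formulas {γ ρs ε σ : ℝ} {L M : ℝ × ℝ} (hγ : 0 < γ) (hε : 0 < ε)
    (h : IsShock γ ρs ε (-1) σ L M) :
    excessVolume ρs M.1 < excessVolume ρs L.1 ∧
    M.2 / M.1 = L.2 / L.1 - √((ε * excessVolume ρs M.1 ^ (-γ) -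
      ε * excessVolume ρs L.1 ^ (-γ)) * (excessVolume ρs L.1 - excessVolume ρs M.1)) ∧
    σ = L.2 / L.1 - √((ε * excessVolume ρs M.1 ^ (-γ) -
      ε * excessVolume ρs L.1 ^ (-γ)) / (excessVolume ρs L.1 - excessVolume ρs M.1)) / L.1 := by
  obtain ⟨m, hm, h1, h2, h3, -, h4⟩ := h.exists_flux hγ hε
  have hX := sub_pos.2 h4
  refine ⟨h4, ?_, ?_⟩
  · rw [← h1, show m ^ 2 * (excessVolume ρs L.1 - excessVolume ρs M.1) *
      (excessVolume ρs L.1 - excessVolume ρs M.1) =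
      (m * (excessVolume ρs L.1 - excessVolume ρs M.1)) ^ 2 by ring,
      Real.sqrt_sq (mul_pos hm hX).le, h2]
  · rw [← h1, mul_div_cancel_right₀ _ hX.ne', Real.sqrt_sq hm.le, h3]

/-- The first wave moves with nearly the left velocity if the end velocities are close. -/
lemma IsRiemannSolution.abs_sub_le {γ ρs ε : ℝ} {L R : ℝ × ℝ} {F : WaveFan} (hγ : 0 < γ)
    (hε : 0 < ε) (h : IsRiemannSolution γ ρs ε L R F) (hL : L.1 ∈ Set.Ioo 0 ρs)
    (hR : R.1 ∈ Set.Ioo 0 ρs) :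
    |F.a₁ - L.2 / L.1| ≤ (√ε * lagSpeed γ (excessVolume ρs L.1) +
      √ε * lagSpeed γ (excessVolume ρs L.1 / 2) +
      2 * (|L.2 / L.1 - R.2 / R.1| + √ε * |lagPrimitive γ (excessVolume ρs L.1) -
        lagPrimitive γ (excessVolume ρs R.1)|) / excessVolume ρs L.1) / L.1 := by
  have hL1 := hL.1
  have hwL := excessVolume_pos hL
  have hwR := excessVolume_pos hR
  have hg1 := lagSpeed_pos hγ hwL
  have hg2 := lagSpeed_pos hγ (half_pos hwL)
  rcases h.first_wave with ⟨-, h₁⟩ | ⟨ha, -⟩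
  · have hM := h₁.right_mem
    have hwM := excessVolume_pos hM
    obtain ⟨m, hm, -, h2, h3, h4, h5⟩ := h₁.exists_flux hγ hε
    have h₂ := isFirstWave_mirror h
    have e1 := h₂.velocity_le (V := max (excessVolume ρs L.1) (excessVolume ρs R.1)) hγ hε hR hM
      (le_max_right _ _) (h5.le.trans (le_max_left _ _))
    simp only [mirror_fst, mirror_snd, neg_div] at e1
    have e2 : lagPrimitive γ (max (excessVolume ρs L.1) (excessVolume ρs R.1)) -
        lagPrimitive γ (excessVolume ρs R.1) ≤
        |lagPrimitive γ (excessVolume ρs L.1) - lagPrimitive γ (excessVolume ρs R.1)| := by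
      rcases max_cases (excessVolume ρs L.1) (excessVolume ρs R.1) with ⟨hmx, -⟩ | ⟨hmx, -⟩ <;>
        rw [hmx]
      · exact le_abs_self _
      · rw [sub_self]; exact abs_nonneg _
    have e3 := mul_le_mul_of_nonneg_left e2 (Real.sqrt_nonneg ε)
    have e4 := le_abs_self (L.2 / L.1 - R.2 / R.1)
    set K := |L.2 / L.1 - R.2 / R.1| + √ε * |lagPrimitive γ (excessVolume ρs L.1) -
        lagPrimitive γ (excessVolume ρs R.1)| with hK
    have hX : m * (excessVolume ρs L.1 - excessVolume ρs F.mid.1) ≤ K := by linarith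
    have hK0 : 0 ≤ K := by positivity
    rw [h3, show L.2 / L.1 - m / L.1 - L.2 / L.1 = -(m / L.1) by ring, abs_neg,
      abs_of_pos (by positivity)]
    refine div_le_div_of_nonneg_right ?_ hL1.le
    -- If at least half of the excess volume is left, the Lax inequality bounds the flux `m`;
    -- otherwise the drop of excess volume is at least half, and the velocity bound `hX` does.
    rcases le_or_gt (excessVolume ρs L.1 / 2) (excessVolume ρs F.mid.1) with h6 | h6
    · have h7 := mul_le_mul_of_nonneg_left
        ((lagSpeed_strictAntiOn hγ).antitoneOn (half_pos hwL) hwM h6) (Real.sqrt_nonneg ε)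
      have h8 : 0 ≤ 2 * K / excessVolume ρs L.1 := by positivity
      have h9 : 0 ≤ √ε * lagSpeed γ (excessVolume ρs L.1) := by positivity
      linarith
    · have h7 : m ≤ 2 * K / excessVolume ρs L.1 := by
        rw [le_div_iff₀ hwL]
        have := mul_le_mul_of_nonneg_left (show excessVolume ρs L.1 / 2 ≤
          excessVolume ρs L.1 - excessVolume ρs F.mid.1 by linarith) hm.le
        linarith
      have h9 : 0 ≤ √ε * lagSpeed γ (excessVolume ρs L.1) := by positivity
      have h8 : 0 ≤ √ε * lagSpeed γ (excessVolume ρs L.1 / 2) := by positivity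
      linarith
  · rw [ha, charSpeed_eq hγ hε _ hL, add_sub_cancel_left, neg_one_mul, abs_neg,
      abs_of_pos (by positivity)]
    refine div_le_div_of_nonneg_right ?_ hL1.le
    rw [add_assoc]
    refine le_add_of_nonneg_right ?_
    positivity

/-- Two-sided bounds of the congested pressure `π` from the difference `D` of the velocities. -/
lemma pressure_bounds {D x y π p r : ℝ} (hx : 0 < x) (hy : 0 < y) (hp : 0 ≤ p) (hr : 0 ≤ r)
    (hπ : 0 ≤ π) (hD : D = √((π - p) * x) + √((π - r) * y)) :
    (D / (√x + √y)) ^ 2 ≤ π ∧ π ≤ (D / (√x + √y)) ^ 2 + (p + r) := by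
  have hS : 0 < √x + √y := add_pos (Real.sqrt_pos.2 hx) (Real.sqrt_pos.2 hy)
  rw [Real.sqrt_mul' _ hx.le, Real.sqrt_mul' _ hy.le] at hD
  have hD0 : 0 ≤ D := by rw [hD]; positivity
  -- Dropping `p` and `r` enlarges both roots, and subtracting `p + r` in each of them diminishes
  -- both.
  have hupper : D ≤ √π * (√x + √y) := by
    rw [hD, mul_add]
    gcongr <;> linarith
  have hlower : √(π - (p + r)) * (√x + √y) ≤ D := by
    rw [hD, mul_add]
    gcongr √(?_) * _ + √(?_) * _ <;> linarith
  constructor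
  · rw [← Real.sq_sqrt hπ]
    exact pow_le_pow_left₀ (by positivity) ((div_le_iff₀ hS).2 hupper) 2
  · rw [← le_div_iff₀ hS] at hlower
    have := (Real.sqrt_le_left (by positivity)).1 hlower
    linarith

/-! ### Passage to the limit `ε → 0⁺`. -/

section Limits

variable {γ ρs ρ q : ℝ} {L : ℝ → ℝ × ℝ}

lemma tendsto_sqrt_nhdsGT_zero : Tendsto (fun ε : ℝ => √ε) (𝓝[>] 0) (𝓝 0) := by
  have := (Real.continuous_sqrt.tendsto 0).mono_left (nhdsWithin_le_nhds (s := Set.Ioi 0))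
  rwa [Real.sqrt_zero] at this

lemma tendsto_id_nhdsGT_zero : Tendsto (fun ε : ℝ => ε) (𝓝[>] 0) (𝓝 0) :=
  tendsto_id.mono_left nhdsWithin_le_nhds

lemma eventually_mem_Ioo (hρ : ρ ∈ Set.Ioo 0 ρs) (hL : Tendsto L (𝓝[>] 0) (𝓝 (ρ, q))) :
    ∀ᶠ ε in 𝓝[>] 0, (L ε).1 ∈ Set.Ioo 0 ρs :=
  hL.fst_nhds.eventually (isOpen_Ioo.mem_nhds hρ)

lemma tendsto_velocity (hρ : ρ ∈ Set.Ioo 0 ρs) (hL : Tendsto L (𝓝[>] 0) (𝓝 (ρ, q))) :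
    Tendsto (fun ε => (L ε).2 / (L ε).1) (𝓝[>] 0) (𝓝 (q / ρ)) :=
  hL.snd_nhds.div hL.fst_nhds hρ.1.ne'

lemma tendsto_excessVolume (hρ : ρ ∈ Set.Ioo 0 ρs) (hL : Tendsto L (𝓝[>] 0) (𝓝 (ρ, q))) :
    Tendsto (fun ε => excessVolume ρs (L ε).1) (𝓝[>] 0) (𝓝 (excessVolume ρs ρ)) :=
  (continuousAt_excessVolume hρ.1.ne').tendsto.comp hL.fst_nhds

lemma tendsto_comp_excessVolume {f : ℝ → ℝ} (hρ : ρ ∈ Set.Ioo 0 ρs)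
    (hL : Tendsto L (𝓝[>] 0) (𝓝 (ρ, q))) (hf : ContinuousAt f (excessVolume ρs ρ)) :
    Tendsto (fun ε => f (excessVolume ρs (L ε).1)) (𝓝[>] 0) (𝓝 (f (excessVolume ρs ρ))) :=
  hf.tendsto.comp (tendsto_excessVolume hρ hL)

lemma tendsto_sqrt_mul {f : ℝ → ℝ} {c : ℝ} (hf : Tendsto f (𝓝[>] 0) (𝓝 c)) :
    Tendsto (fun ε => √ε * f ε) (𝓝[>] 0) (𝓝 0) := by
  simpa using tendsto_sqrt_nhdsGT_zero.mul hf

lemma tendsto_mul_rpow_excessVolume (hρ : ρ ∈ Set.Ioo 0 ρs)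
    (hL : Tendsto L (𝓝[>] 0) (𝓝 (ρ, q))) :
    Tendsto (fun ε => ε * excessVolume ρs (L ε).1 ^ (-γ)) (𝓝[>] 0) (𝓝 0) := by
  simpa using tendsto_id_nhdsGT_zero.mul (tendsto_comp_excessVolume hρ hL
    (Real.continuousAt_rpow_const _ (-γ) (Or.inl (excessVolume_pos hρ).ne')))

lemma tendsto_charSpeed (hγ : 0 < γ) (hρ : ρ ∈ Set.Ioo 0 ρs)
    (hL : Tendsto L (𝓝[>] 0) (𝓝 (ρ, q))) (s : ℝ) :
    Tendsto (fun ε => charSpeed γ ρs ε s (L ε)) (𝓝[>] 0) (𝓝 (q / ρ)) := by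
  have h1 := tendsto_sqrt_mul (tendsto_comp_excessVolume hρ hL
    (continuousAt_lagSpeed (γ := γ) (excessVolume_pos hρ)))
  have h2 := (tendsto_velocity hρ hL).add ((h1.div hL.fst_nhds hρ.1.ne').const_mul s)
  rw [zero_div, mul_zero, add_zero] at h2
  refine h2.congr' ?_
  filter_upwards [eventually_mem_Ioo hρ hL, self_mem_nhdsWithin] with ε h3 h4
  exact (charSpeed_eq hγ h4 s h3).symm

lemma tendsto_fullState (hρ : ρ ∈ Set.Ioo 0 ρs) (hL : Tendsto L (𝓝[>] 0) (𝓝 (ρ, q))) :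
    Tendsto (fun ε => fullState γ ρs ε (L ε)) (𝓝[>] 0) (𝓝 (ρ, q, 0)) := by
  refine hL.fst_nhds.prodMk_nhds (hL.snd_nhds.prodMk_nhds
    ((tendsto_mul_rpow_excessVolume (γ := γ) hρ hL).congr' ?_))
  filter_upwards [eventually_mem_Ioo hρ hL] with ε h3
  rw [pressure_eq h3]

lemma tendsto_mirror (hL : Tendsto L (𝓝[>] 0) (𝓝 (ρ, q))) :
    Tendsto (fun ε => mirror (L ε)) (𝓝[>] 0) (𝓝 (ρ, -q)) :=
  (continuous_mirror.tendsto _).comp hL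

end Limits

section Convergence

variable {γ ρs : ℝ} {L R : ℝ → ℝ × ℝ} {F : ℝ → WaveFan} {A M B : ℝ × ℝ × ℝ}

/-- The profile is constant outside `[a₁, b₂]`, so the limits of these two speeds settle the outer
regions and only the middle one needs the uniform estimate `hM`. -/
lemma convergesAwayFrom_twoJumps {s₁ s₂ : ℝ}
    (hF : ∀ᶠ ε in 𝓝[>] (0 : ℝ), IsRiemannSolution γ ρs ε (L ε) (R ε) (F ε))
    (hA : Tendsto (fun ε => fullState γ ρs ε (L ε)) (𝓝[>] 0) (𝓝 A))
    (hB : Tendsto (fun ε => fullState γ ρs ε (R ε)) (𝓝[>] 0) (𝓝 B))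
    (h₁ : Tendsto (fun ε => (F ε).a₁) (𝓝[>] 0) (𝓝 s₁))
    (h₂ : Tendsto (fun ε => (F ε).b₂) (𝓝[>] 0) (𝓝 s₂))
    (hM : ∀ δ > 0, ∀ η > 0, ∀ᶠ ε in 𝓝[>] (0 : ℝ), ∀ ξ ∈ Set.Icc (s₁ + δ) (s₂ - δ),
      dist M (fullState γ ρs ε ((F ε).profile ξ)) < η) :
    ConvergesAwayFrom γ ρs F (twoJumps s₁ s₂ A M B) {s₁, s₂} := by
  intro δ hδ
  rw [Metric.tendstoUniformlyOn_iff]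
  intro η hη
  filter_upwards [hF, hA.eventually (Metric.ball_mem_nhds A hη),
    hB.eventually (Metric.ball_mem_nhds B hη), h₁.eventually (lt_mem_nhds (sub_lt_self s₁ hδ)),
    h₂.eventually (gt_mem_nhds (lt_add_of_pos_right s₂ hδ)), hM δ hδ η hη]
    with ε hS hA' hB' h3 h4 h5 ξ hξ
  have e1 := hξ s₁ (by simp)
  have e2 := hξ s₂ (by simp)
  unfold twoJumps
  split_ifs with c1 c2
  · rw [abs_of_neg (by linarith)] at e1
    rw [hS.left_const ξ (by linarith), dist_comm]
    exact hA'
  · rw [abs_of_nonneg (by linarith)] at e1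
    rw [abs_of_neg (by linarith)] at e2
    exact h5 ξ ⟨by linarith, by linarith⟩
  · rw [abs_of_nonneg (by linarith)] at e2
    rw [hS.right_const ξ (by linarith), dist_comm]
    exact hB'

/-- With coinciding speeds the middle interval is empty, so the choice of middle state is
immaterial. -/
lemma convergesAwayFrom_oneJump {s : ℝ}
    (hF : ∀ᶠ ε in 𝓝[>] (0 : ℝ), IsRiemannSolution γ ρs ε (L ε) (R ε) (F ε))
    (hA : Tendsto (fun ε => fullState γ ρs ε (L ε)) (𝓝[>] 0) (𝓝 A))
    (hB : Tendsto (fun ε => fullState γ ρs ε (R ε)) (𝓝[>] 0) (𝓝 B))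
    (h₁ : Tendsto (fun ε => (F ε).a₁) (𝓝[>] 0) (𝓝 s))
    (h₂ : Tendsto (fun ε => (F ε).b₂) (𝓝[>] 0) (𝓝 s)) :
    ConvergesAwayFrom γ ρs F (oneJump s A B) {s} := by
  have h := convergesAwayFrom_twoJumps (M := B) hF hA hB h₁ h₂ fun δ hδ η _ =>
    Eventually.of_forall fun ε ξ hξ => absurd (hξ.1.trans hξ.2) (by linarith)
  rw [Finset.pair_eq_singleton] at h
  convert h using 1
  ext1 ξ
  unfold oneJump twoJumps
  split_ifs <;> rfl

end Convergence

lemma tendsto_rareBound (γ B V : ℝ) :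
    Tendsto (fun ε => rareBound γ ε V B) (𝓝[>] 0) (𝓝 (1 / V + B / V)) := by
  have h1 := tendsto_sqrt_nhdsGT_zero.mul_const (lagSpeed γ V)
  have h2 := tendsto_id_nhdsGT_zero.mul_const (V ^ (-γ))
  simpa [rareBound] using ((h1.const_add (B / V)).const_add (1 / V)).add h2

section Cases

variable {γ ρs ρl ql ρr qr : ℝ} {L R : ℝ → ℝ × ℝ} {F : ℝ → WaveFan}

/-- The middle part of the fan between two receding states is asymptotically the vacuum. -/
lemma eventually_dilute (hγ : 0 < γ) (hρl : ρl ∈ Set.Ioo 0 ρs) (hρr : ρr ∈ Set.Ioo 0 ρs)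
    (hL : Tendsto L (𝓝[>] 0) (𝓝 (ρl, ql))) (hR : Tendsto R (𝓝[>] 0) (𝓝 (ρr, qr)))
    (hF : ∀ᶠ ε in 𝓝[>] (0 : ℝ), IsRiemannSolution γ ρs ε (L ε) (R ε) (F ε))
    (hlt : ql / ρl < qr / ρr) {δ η : ℝ} (hδ : 0 < δ) (hη : 0 < η) :
    ∀ᶠ ε in 𝓝[>] (0 : ℝ), (F ε).a₁ = charSpeed γ ρs ε (-1) (L ε) ∧
      (F ε).b₂ = charSpeed γ ρs ε 1 (R ε) ∧ ‖fullState γ ρs ε (F ε).mid‖ < η ∧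
      ∀ ξ ∈ Set.Icc (ql / ρl + δ) (qr / ρr - δ),
        ‖fullState γ ρs ε ((F ε).profile ξ)‖ < η := by
  -- The outer speeds tend to `u_ℓ` and `u_r`, so the margin `1` makes `B` an eventual bound for the
  -- sum of their absolute values.
  set B := |ql / ρl| + |qr / ρr| + 1 with hB
  have hVlim : Tendsto (fun V : ℝ => 1 / V + B / V) atTop (𝓝 0) := by
    simpa using (tendsto_const_nhds (x := (1 : ℝ))).div_atTop tendsto_id |>.add
      ((tendsto_const_nhds (x := B)).div_atTop tendsto_id)
  -- `V` is fixed before `ε`: the bound of the dilute part tends to `1 / V + B / V` as `ε → 0⁺`, so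
  -- this limit is made smaller than `η`.
  obtain ⟨V, hVη, hVl, hVr⟩ := ((hVlim.eventually (gt_mem_nhds hη)).and
    ((eventually_gt_atTop (excessVolume ρs ρl)).and
      (eventually_gt_atTop (excessVolume ρs ρr)))).exists
  have hρs := hρl.1.trans hρl.2
  have hwl := excessVolume_pos hρl
  have hwr := excessVolume_pos hρr
  have hV := hwl.trans hVl
  have hGl := tendsto_comp_excessVolume hρl hL (continuousAt_lagPrimitive (γ := γ) hwl)
  have hGr := tendsto_comp_excessVolume hρr hR (continuousAt_lagPrimitive (γ := γ) hwr)
  have hHl := tendsto_sqrt_mul ((tendsto_comp_excessVolume hρl hL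
    (hasDerivAt_fanSpeed (γ := γ) (ρs := ρs) hwl).continuousAt).const_sub (fanSpeed γ ρs V))
  have hHr := tendsto_sqrt_mul ((tendsto_comp_excessVolume hρr hR
    (hasDerivAt_fanSpeed (γ := γ) (ρs := ρs) hwr).continuousAt).const_sub (fanSpeed γ ρs V))
  have hG := tendsto_sqrt_mul ((hGl.const_sub (2 * lagPrimitive γ V)).sub hGr)
  have hu := (tendsto_velocity hρr hR).sub (tendsto_velocity hρl hL)
  have hcl := tendsto_charSpeed hγ hρl hL (-1)
  have hcr := tendsto_charSpeed hγ hρr hR 1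
  have hab : Tendsto (fun ε => |charSpeed γ ρs ε (-1) (L ε)| + |charSpeed γ ρs ε 1 (R ε)|)
      (𝓝[>] 0) (𝓝 (|ql / ρl| + |qr / ρr|)) := hcl.abs.add hcr.abs
  have hδ2 : 0 < δ / 2 := half_pos hδ
  filter_upwards [self_mem_nhdsWithin, hF, eventually_mem_Ioo hρl hL, eventually_mem_Ioo hρr hR,
    (tendsto_excessVolume hρl hL).eventually (gt_mem_nhds hVl),
    (tendsto_excessVolume hρr hR).eventually (gt_mem_nhds hVr),
    hG.eventually_lt hu (sub_pos.2 hlt),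
    (tendsto_rareBound γ B V).eventually (gt_mem_nhds hVη),
    hab.eventually (gt_mem_nhds (lt_add_one _)),
    hHl.eventually (gt_mem_nhds hδ2), hHr.eventually (gt_mem_nhds hδ2),
    hcl.eventually (gt_mem_nhds (lt_add_of_pos_right _ hδ2)),
    hcr.eventually (lt_mem_nhds (sub_lt_self _ hδ2))]
    with ε hε hS hLm hRm h1 h2 h3 h4 h5 h6 h7 h8 h9
  obtain ⟨ha, hb, hmid, hp⟩ := hS.dilute hγ hε hLm hRm h1.le h2.le h3
  have hle : rareBound γ ε V (|(F ε).a₁| + |(F ε).b₂|) < η := by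
    refine lt_of_le_of_lt ?_ h4
    rw [ha, hb]
    unfold rareBound
    gcongr
  refine ⟨ha, hb, hmid.trans_lt hle, fun ξ hξ => (hp ξ ?_ ?_ ?_).trans_lt hle⟩
  · exact ⟨by linarith [hξ.1], by linarith [hξ.2]⟩
  · linarith [hξ.1]
  · linarith [hξ.2]

/-- In the bound of `IsRiemannSolution.abs_sub_le` every term carries a factor `√ε` or the
difference of the end velocities. The reflected statement handles the right end. -/
lemma tendsto_left_end (hγ : 0 < γ) (hρl : ρl ∈ Set.Ioo 0 ρs) (hρr : ρr ∈ Set.Ioo 0 ρs)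
    (hL : Tendsto L (𝓝[>] 0) (𝓝 (ρl, ql))) (hR : Tendsto R (𝓝[>] 0) (𝓝 (ρr, qr)))
    (hF : ∀ᶠ ε in 𝓝[>] (0 : ℝ), IsRiemannSolution γ ρs ε (L ε) (R ε) (F ε))
    (heq : ql / ρl = qr / ρr) : Tendsto (fun ε => (F ε).a₁) (𝓝[>] 0) (𝓝 (ql / ρl)) := by
  have hwl := excessVolume_pos hρl
  have hwr := excessVolume_pos hρr
  have hul := tendsto_velocity hρl hL
  have hur := tendsto_velocity hρr hR
  have hg1 := tendsto_sqrt_mul (tendsto_comp_excessVolume hρl hL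
    (continuousAt_lagSpeed (γ := γ) hwl))
  have hg2 := tendsto_sqrt_mul (tendsto_comp_excessVolume (f := fun w => lagSpeed γ (w / 2)) hρl hL
    ((continuousAt_lagSpeed (γ := γ) (half_pos hwl)).comp (f := fun w : ℝ => w / 2)
      (by fun_prop)))
  have hG := tendsto_sqrt_mul ((tendsto_comp_excessVolume hρl hL
    (continuousAt_lagPrimitive (γ := γ) hwl)).sub (tendsto_comp_excessVolume hρr hR
    (continuousAt_lagPrimitive (γ := γ) hwr))).abs
  have hbound := ((hg1.add hg2).add ((((hul.sub hur).abs.add hG).const_mul 2).div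
    (tendsto_excessVolume hρl hL) hwl.ne')).div hL.fst_nhds hρl.1.ne'
  rw [heq, sub_self, abs_zero, add_zero, mul_zero, zero_div, add_zero, zero_div] at hbound
  have h0 : Tendsto (fun ε => (F ε).a₁ - (L ε).2 / (L ε).1) (𝓝[>] 0) (𝓝 0) := by
    refine squeeze_zero_norm' ?_ hbound
    filter_upwards [self_mem_nhdsWithin, hF, eventually_mem_Ioo hρl hL,
      eventually_mem_Ioo hρr hR] with ε hε hS hLm hRm
    exact hS.abs_sub_le hγ hε hLm hRm
  simpa using h0.add hul

lemma eventually_first_isShock (hγ : 0 < γ) (hρl : ρl ∈ Set.Ioo 0 ρs) (hρr : ρr ∈ Set.Ioo 0 ρs)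
    (hL : Tendsto L (𝓝[>] 0) (𝓝 (ρl, ql))) (hR : Tendsto R (𝓝[>] 0) (𝓝 (ρr, qr)))
    (hF : ∀ᶠ ε in 𝓝[>] (0 : ℝ), IsRiemannSolution γ ρs ε (L ε) (R ε) (F ε))
    (hlt : qr / ρr < ql / ρl) :
    ∀ᶠ ε in 𝓝[>] (0 : ℝ), (F ε).a₁ = (F ε).b₁ ∧
      IsShock γ ρs ε (-1) (F ε).a₁ (L ε) (F ε).mid := by
  have hul := tendsto_velocity hρl hL
  have hur := tendsto_velocity hρr hR
  have hp := (tendsto_mul_rpow_excessVolume (γ := γ) hρl hL).mul (tendsto_excessVolume hρr hR)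
  rw [zero_mul] at hp
  filter_upwards [self_mem_nhdsWithin, hF, eventually_mem_Ioo hρl hL, hur.eventually_lt hul hlt,
    hp.eventually_lt ((hul.sub hur).pow 2) (pow_pos (sub_pos.2 hlt) 2),
    (tendsto_charSpeed hγ hρr hR 1).eventually_lt (tendsto_charSpeed hγ hρl hL (-1)) hlt]
    with ε hε hS hLm h1 h2 h3
  exact hS.first_isShock hγ hε hLm h1 h2 h3

/-- Between two approaching states the intermediate density tends to its maximal value, and the
pressure has the limit determined by the jump of the velocity. -/
lemma tendsto_mid_of_shocks (hγ : 0 < γ) (hρl : ρl ∈ Set.Ioo 0 ρs) (hρr : ρr ∈ Set.Ioo 0 ρs)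
    (hL : Tendsto L (𝓝[>] 0) (𝓝 (ρl, ql))) (hR : Tendsto R (𝓝[>] 0) (𝓝 (ρr, qr)))
    (hlt : qr / ρr < ql / ρl)
    (h₁ : ∀ᶠ ε in 𝓝[>] (0 : ℝ), IsShock γ ρs ε (-1) (F ε).a₁ (L ε) (F ε).mid)
    (h₂ : ∀ᶠ ε in 𝓝[>] (0 : ℝ),
      IsShock γ ρs ε (-1) (-(F ε).a₂) (mirror (R ε)) (mirror (F ε).mid)) :
    Tendsto (fun ε => excessVolume ρs (F ε).mid.1) (𝓝[>] 0) (𝓝 0) ∧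
    Tendsto (fun ε => ε * excessVolume ρs (F ε).mid.1 ^ (-γ)) (𝓝[>] 0)
      (𝓝 (((ql / ρl - qr / ρr) / (√(excessVolume ρs ρl) + √(excessVolume ρs ρr))) ^ 2)) := by
  have hul := tendsto_velocity hρl hL
  have hur := tendsto_velocity hρr hR
  have hu := hul.sub hur
  have hwl := tendsto_excessVolume hρl hL
  have hwr := tendsto_excessVolume hρr hR
  have hpl := tendsto_mul_rpow_excessVolume (γ := γ) hρl hL
  have hpr := tendsto_mul_rpow_excessVolume (γ := γ) hρr hR
  have hS : 0 < √(excessVolume ρs ρl) + √(excessVolume ρs ρr) :=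
    add_pos (Real.sqrt_pos.2 (excessVolume_pos hρl)) (Real.sqrt_pos.2 (excessVolume_pos hρr))
  have hw0 : Tendsto (fun ε => excessVolume ρs (F ε).mid.1) (𝓝[>] 0) (𝓝 0) := by
    refine tendsto_order.2 ⟨fun x hx => ?_, fun x hx => ?_⟩
    · filter_upwards [h₁] with ε h using hx.trans (excessVolume_pos h.right_mem)
    -- An excess volume of at least `x` in the middle would keep its scaled pressure below `ε x ^
    -- (-γ)`; both shock strengths would vanish and could not add up to a velocity drop with
    -- positive limit.
    · have hlim : Tendsto (fun ε => √(ε * x ^ (-γ) * excessVolume ρs (L ε).1) +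
          √(ε * x ^ (-γ) * excessVolume ρs (R ε).1)) (𝓝[>] 0) (𝓝 0) := by
        have h3 := tendsto_id_nhdsGT_zero.mul_const (x ^ (-γ))
        simpa using (h3.mul hwl).sqrt.add (h3.mul hwr).sqrt
      filter_upwards [self_mem_nhdsWithin, h₁, h₂, hlim.eventually_lt hu (sub_pos.2 hlt)]
        with ε hε h3 h4 h5
      by_contra hle
      push Not at hle
      have hε' : 0 < ε := hε
      have key : ∀ w, 0 < w → excessVolume ρs (F ε).mid.1 < w →
          √((ε * excessVolume ρs (F ε).mid.1 ^ (-γ) - ε * w ^ (-γ)) *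
            (w - excessVolume ρs (F ε).mid.1)) ≤ √(ε * x ^ (-γ) * w) := by
        intro w hw hlt'
        have hm := excessVolume_pos h3.right_mem
        refine Real.sqrt_le_sqrt (mul_le_mul ?_ (by linarith) (by linarith) (by positivity))
        have e1 := mul_le_mul_of_nonneg_left
          (Real.rpow_le_rpow_of_nonpos hx hle (neg_nonpos.2 hγ.le)) hε'.le
        have e2 : 0 ≤ ε * w ^ (-γ) := by positivity
        linarith
      obtain ⟨f1, f2, -⟩ := h3.formulas hγ hε'
      obtain ⟨g1, g2, -⟩ := h4.formulas hγ hε'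
      simp only [mirror_fst, mirror_snd, neg_div] at g1 g2
      have e1 := key _ (excessVolume_pos h3.left_mem) f1
      have e2 := key _ (excessVolume_pos h4.left_mem) g1
      simp only [mirror_fst] at e2
      linarith
  refine ⟨hw0, ?_⟩
  -- The bounds of `pressure_bounds` differ by the scaled pressures of the end states, which vanish,
  -- so they squeeze the scaled pressure of the middle state.
  have hlo : Tendsto (fun ε => (((L ε).2 / (L ε).1 - (R ε).2 / (R ε).1) /
      (√(excessVolume ρs (L ε).1 - excessVolume ρs (F ε).mid.1) +
        √(excessVolume ρs (R ε).1 - excessVolume ρs (F ε).mid.1))) ^ 2) (𝓝[>] 0)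
      (𝓝 (((ql / ρl - qr / ρr) / (√(excessVolume ρs ρl) + √(excessVolume ρs ρr))) ^ 2)) := by
    have h3 := (hwl.sub hw0).sqrt.add (hwr.sub hw0).sqrt
    rw [sub_zero, sub_zero] at h3
    exact (hu.div h3 hS.ne').pow 2
  have hup := hlo.add (hpl.add hpr)
  rw [add_zero, add_zero] at hup
  have hb : ∀ᶠ ε in 𝓝[>] (0 : ℝ), (((L ε).2 / (L ε).1 - (R ε).2 / (R ε).1) /
      (√(excessVolume ρs (L ε).1 - excessVolume ρs (F ε).mid.1) +
        √(excessVolume ρs (R ε).1 - excessVolume ρs (F ε).mid.1))) ^ 2 ≤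
        ε * excessVolume ρs (F ε).mid.1 ^ (-γ) ∧
      ε * excessVolume ρs (F ε).mid.1 ^ (-γ) ≤
        (((L ε).2 / (L ε).1 - (R ε).2 / (R ε).1) /
      (√(excessVolume ρs (L ε).1 - excessVolume ρs (F ε).mid.1) +
        √(excessVolume ρs (R ε).1 - excessVolume ρs (F ε).mid.1))) ^ 2 +
        (ε * excessVolume ρs (L ε).1 ^ (-γ) + ε * excessVolume ρs (R ε).1 ^ (-γ)) := by
    filter_upwards [self_mem_nhdsWithin, h₁, h₂] with ε hε h3 h4
    have hε' : 0 < ε := hε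
    obtain ⟨f1, f2, -⟩ := h3.formulas hγ hε'
    obtain ⟨g1, g2, -⟩ := h4.formulas hγ hε'
    simp only [mirror_fst, mirror_snd, neg_div] at g1 g2
    have hl := excessVolume_pos h3.left_mem
    have hm := excessVolume_pos h3.right_mem
    have hr : 0 < excessVolume ρs (R ε).1 := excessVolume_pos h4.left_mem
    exact pressure_bounds (D := (L ε).2 / (L ε).1 - (R ε).2 / (R ε).1)
      (π := ε * excessVolume ρs (F ε).mid.1 ^ (-γ))
      (p := ε * excessVolume ρs (L ε).1 ^ (-γ)) (r := ε * excessVolume ρs (R ε).1 ^ (-γ))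
      (sub_pos.2 f1) (sub_pos.2 g1) (by positivity) (by positivity) (by positivity) (by linarith)
  exact tendsto_of_tendsto_of_tendsto_of_le_of_le' hlo hup (hb.mono fun _ h => h.1)
    (hb.mono fun _ h => h.2)

lemma tendsto_shock {p : ℝ} {σ : ℝ → ℝ} {M : ℝ → ℝ × ℝ} (hγ : 0 < γ) (hρl : ρl ∈ Set.Ioo 0 ρs)
    (hL : Tendsto L (𝓝[>] 0) (𝓝 (ρl, ql)))
    (h : ∀ᶠ ε in 𝓝[>] (0 : ℝ), IsShock γ ρs ε (-1) (σ ε) (L ε) (M ε))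
    (hw : Tendsto (fun ε => excessVolume ρs (M ε).1) (𝓝[>] 0) (𝓝 0))
    (hp : Tendsto (fun ε => ε * excessVolume ρs (M ε).1 ^ (-γ)) (𝓝[>] 0) (𝓝 p)) :
    Tendsto σ (𝓝[>] 0) (𝓝 (ql / ρl - √(p / excessVolume ρs ρl) / ρl)) ∧
    Tendsto (fun ε => (M ε).2 / (M ε).1) (𝓝[>] 0)
      (𝓝 (ql / ρl - √(p * excessVolume ρs ρl))) := by
  have hul := tendsto_velocity hρl hL
  have hd := (tendsto_excessVolume hρl hL).sub hw
  have hn := hp.sub (tendsto_mul_rpow_excessVolume (γ := γ) hρl hL)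
  rw [sub_zero] at hd hn
  constructor
  · refine (hul.sub ((hn.div hd (excessVolume_pos hρl).ne').sqrt.div hL.fst_nhds
      hρl.1.ne')).congr' ?_
    filter_upwards [self_mem_nhdsWithin, h] with ε hε h3
    exact (h3.formulas hγ hε).2.2.symm
  · refine (hul.sub (hn.mul hd).sqrt).congr' ?_
    filter_upwards [self_mem_nhdsWithin, h] with ε hε h3
    exact (h3.formulas hγ hε).2.1.symm

end Cases

/-! ### Waves of the limit system and closed forms of their strengths. -/

/-- A discontinuity between a free state and a congested state, crossed by the mass flux `m ≠ 0`. -/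
lemma isLimitShock_of_flux {ρs ρ q σ m qt pb : ℝ} (hρ : ρ ∈ Set.Ioo 0 ρs) (hm : m ≠ 0)
    (hq : q = m + σ * ρ) (hqt : qt = m + σ * ρs) (hpb : pb = m ^ 2 * excessVolume ρs ρ) :
    IsLimitShock ρs σ (ρ, q, 0) (ρs, qt, pb) ∧ IsLimitShock ρs σ (ρs, qt, pb) (ρ, q, 0) := by
  have h1 := hρ.1
  have hρs := hρ.1.trans hρ.2
  have hpb0 : 0 ≤ pb := hpb ▸ mul_nonneg (sq_nonneg m) (excessVolume_pos hρ).le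
  have hfree : IsLimitState ρs (ρ, q, 0) := ⟨h1.le, hρ.2.le, le_rfl, mul_zero _,
    fun h => absurd h h1.ne'⟩
  have hcong : IsLimitState ρs (ρs, qt, pb) := ⟨hρs.le, le_rfl, hpb0, by simp,
    fun h => absurd h hρs.ne'⟩
  have hmass : qt - q = σ * (ρs - ρ) := by rw [hq, hqt]; ring
  have hmom : (qt ^ 2 / ρs + pb) - (q ^ 2 / ρ + 0) = σ * (qt - q) := by
    have e1 : q ^ 2 / ρ = m ^ 2 * (1 / ρ) + 2 * m * σ + σ ^ 2 * ρ := by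
      rw [hq]; field_simp; ring
    have e2 : qt ^ 2 / ρs = m ^ 2 * (1 / ρs) + 2 * m * σ + σ ^ 2 * ρs := by
      rw [hqt]; field_simp; ring
    rw [e1, e2, hmass, hpb, excessVolume]
    ring
  have hf1 : q - σ * ρ ≠ 0 := by rw [hq]; simpa using hm
  have hf2 : qt - σ * ρs ≠ 0 := by rw [hqt]; simpa using hm
  have hne : ((ρ, q, 0) : ℝ × ℝ × ℝ) ≠ (ρs, qt, pb) := fun h => hρ.2.ne (congrArg Prod.fst h)
  exact ⟨⟨⟨hfree, hcong, hmass, hmom⟩, hne, hf1, hf2⟩,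
    ⟨⟨hcong, hfree, by simp only; linarith, by simp only at hmom ⊢; linarith⟩, hne.symm, hf2, hf1⟩⟩

lemma isContactWave_of_velocity {ρs ρ₁ ρ₂ u : ℝ} (h₁ : ρ₁ ∈ Set.Ico 0 ρs) (h₂ : ρ₂ ∈ Set.Ico 0 ρs) :
    IsContactWave ρs u (ρ₁, ρ₁ * u, 0) (ρ₂, ρ₂ * u, 0) := by
  have hst : ∀ ρ ∈ Set.Ico 0 ρs, IsLimitState ρs (ρ, ρ * u, 0) := fun ρ h =>
    ⟨h.1, h.2.le, le_rfl, mul_zero _, fun h0 => by simp only at h0 ⊢; rw [h0, zero_mul]⟩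
  -- At the vacuum both sides are zero by the convention for division by zero.
  have hflux : ∀ ρ : ℝ, (ρ * u) ^ 2 / ρ = ρ * u ^ 2 := fun ρ => by
    rcases eq_or_ne ρ 0 with rfl | h
    · simp
    · field_simp
  refine ⟨⟨hst _ h₁, hst _ h₂, ?_, ?_⟩, rfl, rfl, rfl⟩
  · simp only; ring
  · simp only [hflux]; ring

lemma excessVolume_eq_div {ρs ρ : ℝ} (h : ρ ∈ Set.Ioo 0 ρs) :
    (ρs - ρ) / (ρ * ρs) = excessVolume ρs ρ := by
  have h1 := h.1.ne'
  have h2 := (h.1.trans h.2).ne'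
  unfold excessVolume
  field_simp

lemma congestedPressure_eq {ρs ρl ul ρr ur : ℝ} (hl : ρl ∈ Set.Ioo 0 ρs)
    (hr : ρr ∈ Set.Ioo 0 ρs) : congestedPressure ρs ρl ul ρr ur =
      ((ul - ur) / (√(excessVolume ρs ρl) + √(excessVolume ρs ρr))) ^ 2 := by
  rw [congestedPressure, excessVolume_eq_div hl, excessVolume_eq_div hr, div_pow, zpow_neg,
    div_eq_mul_inv]
  norm_cast

/-- Next to a congested state of pressure `p`, `√(p / w)` is the mass flux across the shock and `√(p
* w)` the velocity jump; this ties the two together. -/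
lemma sqrt_mul_excessVolume {ρs ρ : ℝ} (h : ρ ∈ Set.Ioo 0 ρs) (p : ℝ) :
    √(p * excessVolume ρs ρ) = √(p / excessVolume ρs ρ) * excessVolume ρs ρ := by
  have hw := excessVolume_pos h
  nth_rewrite 3 [← Real.sqrt_sq hw.le]
  rw [← Real.sqrt_mul' _ (sq_nonneg _)]
  congr 1
  field_simp

lemma sqrt_mul_sqrt_congested {ρs ρ : ℝ} (h : ρ ∈ Set.Ioo 0 ρs) (p : ℝ) :
    √(ρs / ρ) * √((ρs - ρ) * p) = ρs * √(p * excessVolume ρs ρ) := by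
  have h1 := h.1
  have h2 := h.1.trans h.2
  nth_rewrite 3 [← Real.sqrt_sq h2.le]
  rw [← Real.sqrt_mul (by positivity), ← Real.sqrt_mul (sq_nonneg _), ← excessVolume_eq_div h]
  congr 1
  field_simp

lemma sqrt_mul_sqrt_speed {ρs ρ : ℝ} (h : ρ ∈ Set.Ioo 0 ρs) (p : ℝ) :
    √(ρs / (ρ * (ρs - ρ))) * √p = √(p / excessVolume ρs ρ) / ρ := by
  have h1 := h.1
  have h2 := h.1.trans h.2
  have h3 : 0 < ρs - ρ := sub_pos.2 h.2
  rw [eq_div_iff h1.ne']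
  nth_rewrite 3 [← Real.sqrt_sq h1.le]
  rw [← Real.sqrt_mul (by positivity), ← Real.sqrt_mul' _ (sq_nonneg _), ← excessVolume_eq_div h]
  congr 1
  field_simp

/-! ### The three cases and the final assembly. -/

section Cases

variable {γ ρs ρl ql ρr qr : ℝ} {L R : ℝ → ℝ × ℝ} {F : ℝ → WaveFan}

lemma receding_limit (hγ : 0 < γ) (hρl : ρl ∈ Set.Ioo 0 ρs) (hρr : ρr ∈ Set.Ioo 0 ρs)
    (hL : Tendsto L (𝓝[>] 0) (𝓝 (ρl, ql))) (hR : Tendsto R (𝓝[>] 0) (𝓝 (ρr, qr)))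
    (hF : ∀ᶠ ε in 𝓝[>] (0 : ℝ), IsRiemannSolution γ ρs ε (L ε) (R ε) (F ε))
    (hlt : ql / ρl < qr / ρr) :
    Tendsto (fun ε => fullState γ ρs ε (F ε).mid) (𝓝[>] 0) (𝓝 (0, 0, 0)) ∧
    ConvergesAwayFrom γ ρs F
      (twoJumps (ql / ρl) (qr / ρr) (ρl, ql, 0) (0, 0, 0) (ρr, qr, 0)) {ql / ρl, qr / ρr} := by
  have hd := fun δ (hδ : 0 < δ) η (hη : 0 < η) =>
    eventually_dilute (δ := δ) (η := η) hγ hρl hρr hL hR hF hlt hδ hη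
  constructor
  · refine Metric.tendsto_nhds.2 fun η hη => (hd 1 one_pos η hη).mono fun ε h => ?_
    rw [show ((0, 0, 0) : ℝ × ℝ × ℝ) = 0 from rfl, dist_zero_right]
    exact h.2.2.1
  · refine convergesAwayFrom_twoJumps hF (tendsto_fullState hρl hL) (tendsto_fullState hρr hR)
      ((tendsto_charSpeed hγ hρl hL (-1)).congr' ?_) ((tendsto_charSpeed hγ hρr hR 1).congr' ?_)
      fun δ hδ η hη => (hd δ hδ η hη).mono fun ε h ξ hξ => ?_
    · exact (hd 1 one_pos 1 one_pos).mono fun ε h => h.1.symm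
    · exact (hd 1 one_pos 1 one_pos).mono fun ε h => h.2.1.symm
    · rw [show ((0, 0, 0) : ℝ × ℝ × ℝ) = 0 from rfl, dist_zero_left]
      exact h.2.2.2 ξ hξ

lemma eventually_mirror (hF : ∀ᶠ ε in 𝓝[>] (0 : ℝ), IsRiemannSolution γ ρs ε (L ε) (R ε) (F ε)) :
    ∀ᶠ ε in 𝓝[>] (0 : ℝ), IsRiemannSolution γ ρs ε (mirror (R ε)) (mirror (L ε)) (F ε).mirror :=
  hF.mono fun _ h => h.mirror

lemma equal_velocity_limit (hγ : 0 < γ) (hρl : ρl ∈ Set.Ioo 0 ρs) (hρr : ρr ∈ Set.Ioo 0 ρs)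
    (hL : Tendsto L (𝓝[>] 0) (𝓝 (ρl, ql))) (hR : Tendsto R (𝓝[>] 0) (𝓝 (ρr, qr)))
    (hF : ∀ᶠ ε in 𝓝[>] (0 : ℝ), IsRiemannSolution γ ρs ε (L ε) (R ε) (F ε))
    (heq : ql / ρl = qr / ρr) :
    ConvergesAwayFrom γ ρs F (oneJump (ql / ρl) (ρl, ql, 0) (ρr, qr, 0)) {ql / ρl} := by
  refine convergesAwayFrom_oneJump hF (tendsto_fullState hρl hL) (tendsto_fullState hρr hR)
    (tendsto_left_end hγ hρl hρr hL hR hF heq) ?_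
  have h := (tendsto_left_end hγ hρr hρl (tendsto_mirror hR) (tendsto_mirror hL)
    (eventually_mirror hF) (by rw [neg_div, neg_div, heq])).neg
  rw [neg_div, neg_neg, ← heq] at h
  exact h.congr fun ε => neg_neg _

/-- The limit of the two shocks that separate two approaching states. -/
lemma approaching_limit (hγ : 0 < γ) (hρl : ρl ∈ Set.Ioo 0 ρs) (hρr : ρr ∈ Set.Ioo 0 ρs)
    (hL : Tendsto L (𝓝[>] 0) (𝓝 (ρl, ql))) (hR : Tendsto R (𝓝[>] 0) (𝓝 (ρr, qr)))
    (hF : ∀ᶠ ε in 𝓝[>] (0 : ℝ), IsRiemannSolution γ ρs ε (L ε) (R ε) (F ε))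
    (hlt : qr / ρr < ql / ρl) {pb : ℝ}
    (hpb : pb = ((ql / ρl - qr / ρr) / (√(excessVolume ρs ρl) + √(excessVolume ρs ρr))) ^ 2) :
    (∀ᶠ ε in 𝓝[>] (0 : ℝ),
      ((F ε).a₁ = (F ε).b₁ ∧ IsShock γ ρs ε (-1) (F ε).a₁ (L ε) (F ε).mid) ∧
      ((F ε).a₂ = (F ε).b₂ ∧ IsShock γ ρs ε 1 (F ε).a₂ (F ε).mid (R ε))) ∧
    Tendsto (fun ε => (F ε).a₁) (𝓝[>] 0) (𝓝 (ql / ρl - √(pb / excessVolume ρs ρl) / ρl)) ∧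
    Tendsto (fun ε => (F ε).a₂) (𝓝[>] 0) (𝓝 (qr / ρr + √(pb / excessVolume ρs ρr) / ρr)) ∧
    Tendsto (fun ε => fullState γ ρs ε (F ε).mid) (𝓝[>] 0)
      (𝓝 (ρs, ρs * (ql / ρl - √(pb * excessVolume ρs ρl)), pb)) := by
  have h₁ := eventually_first_isShock hγ hρl hρr hL hR hF hlt
  have h₂ : ∀ᶠ ε in 𝓝[>] (0 : ℝ), -(F ε).b₂ = -(F ε).a₂ ∧
      IsShock γ ρs ε (-1) (-(F ε).b₂) (mirror (R ε)) (mirror (F ε).mid) :=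
    eventually_first_isShock hγ hρr hρl (tendsto_mirror hR) (tendsto_mirror hL)
      (eventually_mirror hF) (by rw [neg_div, neg_div]; linarith)
  have h₂' : ∀ᶠ ε in 𝓝[>] (0 : ℝ),
      IsShock γ ρs ε (-1) (-(F ε).a₂) (mirror (R ε)) (mirror (F ε).mid) :=
    h₂.mono fun ε h => h.1 ▸ h.2
  have h₁' := h₁.mono fun ε h => h.2
  obtain ⟨hw, hp⟩ := tendsto_mid_of_shocks hγ hρl hρr hL hR hlt h₁' h₂'
  rw [← hpb] at hp
  obtain ⟨hσ, hu⟩ := tendsto_shock hγ hρl hL h₁' hw hp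
  obtain ⟨hσ', -⟩ := tendsto_shock hγ hρr (tendsto_mirror hR) h₂' hw hp
  refine ⟨?_, hσ, ?_, ?_⟩
  · filter_upwards [h₁, h₂, h₂'] with ε h3 h4 h5
    refine ⟨h3, (neg_inj.1 h4.1).symm, ?_⟩
    simpa using h5.mirror
  · have h3 := hσ'.neg
    rw [neg_div, neg_sub, sub_neg_eq_add, add_comm] at h3
    exact h3.congr fun ε => neg_neg _
  · have hρs := hρl.1.trans hρl.2
    have hρ : Tendsto (fun ε => (F ε).mid.1) (𝓝[>] 0) (𝓝 ρs) := by
      have h3 := (hw.add_const (1 / ρs)).inv₀ (by rw [zero_add]; exact (one_div_pos.2 hρs).ne')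
      rw [zero_add, one_div, inv_inv] at h3
      refine h3.congr fun ε => ?_
      rw [← one_div ρs, excessVolume_add, one_div, inv_inv]
    refine hρ.prodMk_nhds (((hρ.mul hu).congr' ?_).prodMk_nhds (hp.congr' ?_))
    · filter_upwards [h₁'] with ε h3
      exact mul_div_cancel₀ _ h3.right_mem.1.ne'
    · filter_upwards [h₁'] with ε h3
      rw [pressure_eq h3.right_mem]

end Cases

theorem mainTheorem1 (γ ρs : ℝ) (hγ : 0 < γ) (hρs : 0 < ρs)
    (ρl ql ρr qr ul ur : ℝ)
    (hρl : 0 < ρl) (hρl' : ρl < ρs) (hρr : 0 < ρr) (hρr' : ρr < ρs)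
    (hul : ul = ql / ρl) (hur : ur = qr / ρr)
    (L R : ℝ → ℝ × ℝ)
    (hL : Tendsto L (𝓝[>] 0) (𝓝 (ρl, ql)))
    (hR : Tendsto R (𝓝[>] 0) (𝓝 (ρr, qr))) :
    (∀ᶠ ε in 𝓝[>] (0 : ℝ), ∃ F : WaveFan, IsRiemannSolution γ ρs ε (L ε) (R ε) F) ∧
    ∀ F : ℝ → WaveFan,
      (∀ᶠ ε in 𝓝[>] (0 : ℝ), IsRiemannSolution γ ρs ε (L ε) (R ε) (F ε)) →
      -- two contact waves around a vacuum
      (ul < ur →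
        Tendsto (fun ε => fullState γ ρs ε (F ε).mid) (𝓝[>] 0) (𝓝 (0, 0, 0)) ∧
        ConvergesAwayFrom γ ρs F
          (twoJumps ul ur (ρl, ql, 0) (0, 0, 0) (ρr, qr, 0)) {ul, ur} ∧
        IsContactWave ρs ul (ρl, ql, 0) (0, 0, 0) ∧
        IsContactWave ρs ur (0, 0, 0) (ρr, qr, 0)) ∧
      -- two shock waves around a congested state
      (ur < ul →
        ∃ qt pb σm σp : ℝ,
          pb = congestedPressure ρs ρl ul ρr ur ∧ 0 < pb ∧
          qt = ul * ρs - √(ρs / ρl) * √((ρs - ρl) * pb) ∧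
          qt = ur * ρs + √(ρs / ρr) * √((ρs - ρr) * pb) ∧
          σm = ul - √(ρs / (ρl * (ρs - ρl))) * √pb ∧
          σp = ur + √(ρs / (ρr * (ρs - ρr))) * √pb ∧
          σm < σp ∧
          (∀ᶠ ε in 𝓝[>] (0 : ℝ),
            ((F ε).a₁ = (F ε).b₁ ∧ IsShock γ ρs ε (-1) (F ε).a₁ (L ε) (F ε).mid) ∧
            ((F ε).a₂ = (F ε).b₂ ∧ IsShock γ ρs ε 1 (F ε).a₂ (F ε).mid (R ε))) ∧
          Tendsto (fun ε => (F ε).a₁) (𝓝[>] 0) (𝓝 σm) ∧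
          Tendsto (fun ε => (F ε).a₂) (𝓝[>] 0) (𝓝 σp) ∧
          Tendsto (fun ε => fullState γ ρs ε (F ε).mid) (𝓝[>] 0) (𝓝 (ρs, qt, pb)) ∧
          ConvergesAwayFrom γ ρs F
            (twoJumps σm σp (ρl, ql, 0) (ρs, qt, pb) (ρr, qr, 0)) {σm, σp} ∧
          IsLimitShock ρs σm (ρl, ql, 0) (ρs, qt, pb) ∧
          IsLimitShock ρs σp (ρs, qt, pb) (ρr, qr, 0)) ∧
      -- a single contact wave
      (ul = ur →
        ConvergesAwayFrom γ ρs F (oneJump ul (ρl, ql, 0) (ρr, qr, 0)) {ul} ∧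
        IsContactWave ρs ul (ρl, ql, 0) (ρr, qr, 0)) := by
  have hml : ρl ∈ Set.Ioo 0 ρs := ⟨hρl, hρl'⟩
  have hmr : ρr ∈ Set.Ioo 0 ρs := ⟨hρr, hρr'⟩
  have hql : ql = ρl * ul := by rw [hul]; field_simp
  have hqr : qr = ρr * ur := by rw [hur]; field_simp
  have hwl := excessVolume_pos hml
  have hwr := excessVolume_pos hmr
  have h0 : (0 : ℝ) ∈ Set.Ico 0 ρs := ⟨le_rfl, hρs⟩
  refine ⟨?_, fun F hF => ⟨fun hlt => ?_, fun hlt => ?_, fun heq => ?_⟩⟩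
  · filter_upwards [self_mem_nhdsWithin, eventually_mem_Ioo hml hL, eventually_mem_Ioo hmr hR]
      with ε hε h1 h2 using exists_isRiemannSolution hγ hε h1 h2
  · obtain ⟨h1, h2⟩ := receding_limit hγ hml hmr hL hR hF (hul ▸ hur ▸ hlt)
    rw [← hul, ← hur] at h2
    refine ⟨h1, h2, ?_, ?_⟩
    · have := isContactWave_of_velocity (u := ul) ⟨hρl.le, hρl'⟩ h0
      rwa [zero_mul, ← hql] at this
    · have := isContactWave_of_velocity (u := ur) h0 ⟨hρr.le, hρr'⟩
      rwa [zero_mul, ← hqr] at this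
  · obtain ⟨pb, hpb⟩ : ∃ pb, pb = congestedPressure ρs ρl ul ρr ur := ⟨_, rfl⟩
    have hpb' := hpb
    rw [congestedPressure_eq hml hmr] at hpb'
    have hS : 0 < √(excessVolume ρs ρl) + √(excessVolume ρs ρr) :=
      add_pos (Real.sqrt_pos.2 hwl) (Real.sqrt_pos.2 hwr)
    have hD : 0 < ul - ur := sub_pos.2 hlt
    have hpb0 : 0 < pb := by rw [hpb']; positivity
    -- The formula for the congested pressure is this balance of velocities; it makes the two
    -- expressions of the intermediate momentum agree.
    have hsum : √(pb * excessVolume ρs ρl) + √(pb * excessVolume ρs ρr) = ul - ur := by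
      rw [Real.sqrt_mul hpb0.le, Real.sqrt_mul hpb0.le, ← mul_add, hpb',
        Real.sqrt_sq (by positivity), div_mul_cancel₀ _ hS.ne']
    obtain ⟨h1, h2, h3, h4⟩ := approaching_limit hγ hml hmr hL hR hF (hul ▸ hur ▸ hlt)
      (pb := pb) (by rw [hpb', hul, hur])
    rw [← hul] at h2 h4
    rw [← hur] at h3
    set m := √(pb / excessVolume ρs ρl) with hm
    set m' := √(pb / excessVolume ρs ρr) with hm'
    have hm0 : 0 < m := Real.sqrt_pos.2 (div_pos hpb0 hwl)
    have hm0' : 0 < m' := Real.sqrt_pos.2 (div_pos hpb0 hwr)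
    have hmsq : pb = m ^ 2 * excessVolume ρs ρl := by
      rw [hm, Real.sq_sqrt (div_pos hpb0 hwl).le, div_mul_cancel₀ _ hwl.ne']
    have hmsq' : pb = (-m') ^ 2 * excessVolume ρs ρr := by
      rw [neg_sq, hm', Real.sq_sqrt (div_pos hpb0 hwr).le, div_mul_cancel₀ _ hwr.ne']
    have hxl := sqrt_mul_excessVolume hml pb
    have hxr := sqrt_mul_excessVolume hmr pb
    rw [← hm] at hxl
    rw [← hm'] at hxr
    set qt := ρs * (ul - √(pb * excessVolume ρs ρl)) with hqt
    have hqt' : qt = ρs * (ur + √(pb * excessVolume ρs ρr)) := by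
      rw [hqt]; congr 1; linarith
    set σm := ul - m / ρl with hσm
    set σp := ur + m' / ρr with hσp
    have e1 : qt = m + σm * ρs := by
      rw [hqt, hxl, hσm, excessVolume]; field_simp; ring
    have e2 : qt = -m' + σp * ρs := by
      rw [hqt', hxr, hσp, excessVolume]; field_simp; ring
    have e3 : ql = m + σm * ρl := by rw [hql, hσm]; field_simp; ring
    have e4 : qr = -m' + σp * ρr := by rw [hqr, hσp]; field_simp; ring
    -- The fluxes through the two shocks have opposite signs: `m + σm * ρs = -m' + σp * ρs` with `m,
    -- m' > 0`.
    have hσ : σm < σp := by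
      have : σm * ρs < σp * ρs := by linarith
      exact lt_of_mul_lt_mul_right this hρs.le
    refine ⟨qt, pb, σm, σp, hpb, hpb0, ?_, ?_, ?_, ?_, hσ, h1, h2, h3, h4, ?_,
      (isLimitShock_of_flux hml hm0.ne' e3 e1 hmsq).1,
      (isLimitShock_of_flux hmr (neg_ne_zero.2 hm0'.ne') e4 e2 hmsq').2⟩
    · rw [sqrt_mul_sqrt_congested hml, hqt]; ring
    · rw [sqrt_mul_sqrt_congested hmr, hqt']; ring
    · rw [sqrt_mul_sqrt_speed hml]
    · rw [sqrt_mul_sqrt_speed hmr]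
    -- Both waves being shocks, the whole middle region is the constant intermediate state, and its
    -- convergence is already uniform in `ξ`.
    · refine convergesAwayFrom_twoJumps hF (tendsto_fullState hml hL) (tendsto_fullState hmr hR)
        h2 (h3.congr' (h1.mono fun ε h => h.2.1)) fun δ hδ η hη => ?_
      filter_upwards [hF, h1, h2.eventually (gt_mem_nhds (lt_add_of_pos_right σm hδ)),
        h3.eventually (lt_mem_nhds (sub_lt_self σp hδ)),
        h4.eventually (Metric.ball_mem_nhds _ hη)] with ε hS h5 h6 h7 h8 ξ hξ
      rw [hS.mid_const ξ ⟨by linarith [hξ.1, h5.1.1], by linarith [hξ.2]⟩, dist_comm]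
      exact h8
  · have h1 := equal_velocity_limit hγ hml hmr hL hR hF (hul ▸ hur ▸ heq)
    rw [← hul] at h1
    refine ⟨h1, ?_⟩
    have := isContactWave_of_velocity (u := ul) ⟨hρl.le, hρl'⟩ ⟨hρr.le, hρr'⟩
    rwa [← hql, heq, ← hqr, ← heq] at this
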